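/- Let $K$ be a field of characteristic zero and let $D$ be a dialgebra over $K$, i.e. a $K$-vector space with bilinear products $\dashv,\vdash$ satisfying $$x\dashv(y\dashv z)=(x\dashv y)\dashv z=x\dashv(y\vdash z),\quad (x\vdash y)\dashv z=x\vdash(y\dashv z),\quad (x\dashv y)\vdash z=x\vdash(y\vdash z)=(x\vdash y)\vdash z .$$ Let $HY^*(D,D)$ be the dialgebra cohomology, i.e. the cohomology of the complex $CY^q(D,D)=\mathrm{Hom}(K[Y_q]\otimes D^{\otimes q},D)$ with $Y_q$ the set of planar binary trees with $q$ vertices, and suppose $\dim HY^2(D,D)=n<\infty$. Write $'$ for linear duals. A deformation of $D$ with base an augmented commutative unital $K$-algebra $(A,\epsilon)$ is an $A$-dialgebra structure on $A\otimes D$ such that $\epsilon\otimes\mathrm{id}\colon A\otimes D\to D$ is a morphism of dialgebras. Let $K=C_0\xleftarrow{p_0}C_1\xleftarrow{p_1}C_2\leftarrow\cdots$, together with deformations $\eta_k$ of $D$ with base $C_k$, be any sequence obtained by the following construction. * $C_1=K\oplus HY^2(D,D)'$ with $(HY^2(D,D)')^2=0$, and $\eta_1$ is the universal infinitesimal deformation: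 for a linear map $\mu$ sending each class in $HY^2(D,D)$ to a representing cocycle, its products on $C_1\otimes D=D\oplus \mathrm{Hom}(HY^2(D,D),D)$ are $(x_1,\phi_1)*(x_2,\phi_2)=(x_1*x_2,\psi)$ with $\psi(\alpha)=\mu(\alpha)(y_*;x_1,x_2)+\phi_1(\alpha)*x_2+x_1*\phi_2(\alpha)$, where $*\in\{\dashv,\vdash\}$, $y_\dashv=[21]$ is the tree in $Y_2$ whose right subtree has a vertex, and $y_\vdash=[12]$ the one whose left subtree has a vertex. * Given $(C_k,\eta_k)$ with $k\ge1$, let $\omega_k\colon H^2_{Harr}(C_k;K)\to HY^3(D,D)$ be the linear map sending the class of an extension of $C_k$ by $K$ to the obstruction to extending $\eta_k$ to that extension. A linear choice of cocycles representing the classes in $H^2_{Harr}(C_k;K)$ defines an extension $0\to H^2_{Harr}(C_k;K)'\to\overline C_{k+1}\to C_k\to0$, and $C_{k+1}$ is the quotient of $\overline C_{k+1}$ by the image of $\omega_k'\colon HY^3(D,D)'\to H^2_{Harr}(C_k;K)'$, so that there is an extension $0\to(\ker\omega_k)'\to C_{k+1}\xrightarrow{p_k}C_k\to0$. Finally $\eta_{k+1}$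 is a deformation of $D$ with base $C_{k+1}$ whose push-out along $p_k$ is $\eta_k$. Let $C=\varprojlim C_k$. Let $K[[HY^2(D,D)']]$ be the formal power series ring over $K$ in $n$ variables and let $m$ be its maximal ideal. Then there is an ideal $I\subseteq m^2$ such that $C\cong K[[HY^2(D,D)']]/I$ as $K$-algebras. -/

import Mathlib

open scoped TensorProduct

namespace DialgebraDeformation

/-- The labels of the two products of a dialgebra: `left` stands for `⊣`, `right` for `⊢`. -/
inductive Side : Type
  | left
  | right

/-- An `R`-dialgebra structure on the `R`-module `M`: `op .left x y` is `x ⊣ y` and `op .right x y`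
is `x ⊢ y`. -/
structure Dialgebra (R : Type*) (M : Type*) [CommSemiring R] [AddCommMonoid M] [Module R M] where
  op : Side → M →ₗ[R] M →ₗ[R] M
  assoc_left : ∀ x y z, op .left x (op .left y z) = op .left (op .left x y) z
  bar_left : ∀ x y z, op .left (op .left x y) z = op .left x (op .right y z)
  assoc_mid : ∀ x y z, op .left (op .right x y) z = op .right x (op .left y z)
  bar_right : ∀ x y z, op .right (op .left x y) z = op .right x (op .right y z)
  assoc_right : ∀ x y z, op .right x (op .right y z) = op .right (op .right x y) z

/-- Delete the `i`-th leaf of a planar binary tree (leaves are numbered `0, 1, …` from left to right);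
the vertex carrying that leaf disappears. A leaf is `nil`, grafting is `node ()`. -/
def delLeaf : ℕ → BinaryTree Unit → BinaryTree Unit
  | _, .nil => .nil
  | i, .node _ l r =>
      if i < l.numLeaves then
        match l with
        | .nil => r
        | .node _ _ _ => .node () (delLeaf i l) r
      else
        match r with
        | .nil => l
        | .node _ _ _ => .node () l (delLeaf (i - l.numLeaves) r)

theorem numNodes_delLeaf (i : ℕ) (t : BinaryTree Unit) :
    (delLeaf i t).numNodes = t.numNodes - 1 := by
  induction t generalizing i with
  | nil => rfl
  | node a l r hl hr =>
    rcases l with _ | _ <;> rcases r with _ | _ <;> unfold delLeaf <;> split_ifs <;>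
      simp_all <;> omega

/-- The orientation of the `i`-th leaf: `left` if it is the left branch of its vertex (drawn like a
backslash), `right` if it is the right branch (drawn like a slash). -/
def leafSide : ℕ → BinaryTree Unit → Side
  | _, .nil => .left
  | i, .node _ l r =>
      if i < l.numLeaves then
        match l with
        | .nil => .left
        | .node _ _ _ => leafSide i l
      else
        match r with
        | .nil => .right
        | .node _ _ _ => leafSide (i - l.numLeaves) r

/-- `Y n` is the set of planar binary trees with `n` vertices. -/
def Y (n : ℕ) : Type := {t : BinaryTree Unit // t.numNodes = n}

/-- The face map `d_i : Y_{n+1} → Y_n`, which deletes the `i`-th leaf. -/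
def Y.face {n : ℕ} (i : ℕ) (y : Y (n + 1)) : Y n :=
  ⟨delLeaf i y.1, by rw [numNodes_delLeaf, y.2]; rfl⟩

/-- The label `∘_i^t` of a tree `t` with `n` vertices, `0 ≤ i ≤ n`: `∘_0` is `⊣` if `t = | ∨ t₁` and `⊢`
otherwise, `∘_n` is `⊢` if `t = t₁ ∨ |` and `⊣` otherwise, and for the inner leaves it is given by
the orientation of the leaf. -/
def treeSide (i : ℕ) (t : BinaryTree Unit) : Side :=
  if i = 0 then
    match t with
    | .node _ .nil _ => .left
    | _ => .right
  else if i = t.numNodes then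
    match t with
    | .node _ _ .nil => .right
    | _ => .left
  else leafSide i t

/-- The label `∘_i^y`. -/
def Y.side {n : ℕ} (i : ℕ) (y : Y n) : Side := treeSide i y.1

/-- The trees `[21] = | ∨ [1]` (for `⊣`) and `[12] = [1] ∨ |` (for `⊢`) of `Y_2`. -/
def Y.two : Side → Y 2
  | .left => ⟨.node () .nil (.node () .nil .nil), rfl⟩
  | .right => ⟨.node () (.node () .nil .nil) .nil, rfl⟩

universe u v
variable {K : Type u} [Field K] {D : Type v} [AddCommGroup D] [Module K D]

variable (K D) in
/-- The cochains `CY^n(D,D) = Hom(K[Y_n] ⊗ D^{⊗ n}, D)`: a multilinear map `D^n → D` for each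
tree in `Y_n`. -/
abbrev CY (n : ℕ) : Type v := Y n → MultilinearMap K (fun _ : Fin n => D) D

/-- Changing one entry of `a` changes one entry of `(a_1, …, β a_i a_{i+1}, …, a_{n+1})`. -/
theorem contractNth_update {D : Type v} (β : D → D → D) {n : ℕ} (i : Fin n) (a : Fin (n + 1) → D)
    (k : Fin (n + 1)) : ∃ (j : Fin n) (h : D → D), (h = id ∨ (∃ z, h = β z) ∨ ∃ z, h = fun x => β x z) ∧
    ∀ x, Fin.contractNth i.castSucc β (Function.update a k x) =
      Function.update (Fin.contractNth i.castSucc β a) j (h x) := by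
  have hi := i.2
  have hk := k.2
  rcases lt_trichotomy k.1 i.1 with h | h | h
  · refine ⟨⟨k, by omega⟩, id, Or.inl rfl, fun x => ?_⟩
    ext l
    simp only [Fin.contractNth, Function.update_apply, Fin.ext_iff, Fin.val_castSucc, Fin.val_succ]
    grind
  · refine ⟨⟨k, by omega⟩, fun x => β x (a i.succ), Or.inr (Or.inr ⟨_, rfl⟩), fun x => ?_⟩
    ext l
    simp only [Fin.contractNth, Function.update_apply, Fin.ext_iff, Fin.val_castSucc, Fin.val_succ]
    have : l.1 = i.1 → l = i := fun h => Fin.ext h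
    grind
  · by_cases h' : k.1 = i.1 + 1
    · refine ⟨i, β (a i.castSucc), Or.inr (Or.inl ⟨_, rfl⟩), fun x => ?_⟩
      ext l
      simp only [Fin.contractNth, Function.update_apply, Fin.ext_iff, Fin.val_castSucc, Fin.val_succ]
      have : l.1 = i.1 → l = i := fun h => Fin.ext h
      grind
    · refine ⟨⟨k - 1, by omega⟩, id, Or.inl rfl, fun x => ?_⟩
      ext l
      simp only [Fin.contractNth, Function.update_apply, Fin.ext_iff, Fin.val_castSucc, Fin.val_succ]
      grind

/-- The map `a ↦ g (a_1, …, β a_i a_{i+1}, …, a_{n+1})` (entries of `a` are indexed from `0` here). -/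
def precompOp (β : D →ₗ[K] D →ₗ[K] D) {n : ℕ} (i : Fin n)
    (g : MultilinearMap K (fun _ : Fin n => D) D) :
    MultilinearMap K (fun _ : Fin (n + 1) => D) D :=
  MultilinearMap.mk' (fun a => g (Fin.contractNth i.castSucc (fun x y => β x y) a))
    (fun a k x y => by
      obtain ⟨j, h, rfl | ⟨z, rfl⟩ | ⟨z, rfl⟩, H⟩ := contractNth_update (fun x y => β x y) i a k <;>
        simp [H])
    (fun a k c x => by
      obtain ⟨j, h, rfl | ⟨z, rfl⟩ | ⟨z, rfl⟩, H⟩ := contractNth_update (fun x y => β x y) i a k <;>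
        simp [H])

/-- The map `a ↦ β a_1 (g (a_2, …, a_{n+1}))`. -/
def faceZero (β : D →ₗ[K] D →ₗ[K] D) {n : ℕ}
    (g : MultilinearMap K (fun _ : Fin n => D) D) :
    MultilinearMap K (fun _ : Fin (n + 1) => D) D :=
  LinearMap.uncurryLeft (M := fun _ : Fin (n + 1) => D)
    { toFun := fun x => (β x).compMultilinearMap g
      map_add' := fun x y => by ext a; simp
      map_smul' := fun c x => by ext a; simp }

/-- The map `a ↦ β (g (a_1, …, a_n)) a_{n+1}`. -/
def faceLast (β : D →ₗ[K] D →ₗ[K] D) {n : ℕ}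
    (g : MultilinearMap K (fun _ : Fin n => D) D) :
    MultilinearMap K (fun _ : Fin (n + 1) => D) D :=
  MultilinearMap.uncurryRight (M := fun _ : Fin (n + 1) => D) (β.compMultilinearMap g)

theorem faceZero_apply (β : D →ₗ[K] D →ₗ[K] D) {n : ℕ}
    (g : MultilinearMap K (fun _ : Fin n => D) D) (a : Fin (n + 1) → D) :
    faceZero β g a = β (a 0) (g (fun i => a i.succ)) := rfl

theorem faceLast_apply (β : D →ₗ[K] D →ₗ[K] D) {n : ℕ}
    (g : MultilinearMap K (fun _ : Fin n => D) D) (a : Fin (n + 1) → D) :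
    faceLast β g a = β (g (fun i => a i.castSucc)) (a (Fin.last n)) := rfl

theorem precompOp_apply (β : D →ₗ[K] D →ₗ[K] D) {n : ℕ} (i : Fin n)
    (g : MultilinearMap K (fun _ : Fin n => D) D) (a : Fin (n + 1) → D) :
    precompOp β i g a = g (Fin.contractNth i.castSucc (fun x y => β x y) a) := rfl

/-- The coboundary operator `δ = ∑ (-1)^i δ^i : CY^n(D,D) → CY^{n+1}(D,D)`. -/
def delta (𝒟 : Dialgebra K D) (n : ℕ) : CY K D n →ₗ[K] CY K D (n + 1) where
  toFun f y :=
    faceZero (𝒟.op (y.side 0)) (f (y.face 0)) +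
    ∑ i : Fin n, (-1 : K) ^ (i.1 + 1) •
      precompOp (𝒟.op (y.side (i.1 + 1))) i (f (y.face (i.1 + 1))) +
    (-1 : K) ^ (n + 1) • faceLast (𝒟.op (y.side (n + 1))) (f (y.face (n + 1)))
  map_add' f g := by
    ext y a
    simp [faceZero, precompOp, faceLast, Finset.sum_add_distrib]
    abel
  map_smul' c f := by
    ext y a
    simp [faceZero, precompOp, faceLast, Finset.smul_sum, smul_smul, mul_comm]

/-- The `n`-cocycles of a dialgebra with coefficients in itself. -/
def cocycles (𝒟 : Dialgebra K D) (n : ℕ) : Submodule K (CY K D n) := LinearMap.ker (delta 𝒟 n)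
/-- The `n`-coboundaries of a dialgebra with coefficients in itself. -/
def coboundaries (𝒟 : Dialgebra K D) : (n : ℕ) → Submodule K (CY K D n)
  | 0 => ⊥
  | n + 1 => LinearMap.range (delta 𝒟 n)
/-- The dialgebra cohomology `HY^n(D,D)`. -/
abbrev HY (𝒟 : Dialgebra K D) (n : ℕ) : Type v :=
  cocycles 𝒟 n ⧸ (coboundaries 𝒟 n).submoduleOf (cocycles 𝒟 n)


section Harrison
universe w x
variable {A : Type w} [CommRing A] [Algebra K A]

/-- Harrison 2-cocycles of the commutative algebra `A` with coefficients in the vector space `M`, on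
which `A` acts through the augmentation `ε`. Harrison 2-cochains are the bilinear maps that vanish on
the shuffles `a ⊗ b - b ⊗ a`. -/
def harrisonCocycles (ε : A →ₐ[K] K) (M : Type x) [AddCommGroup M] [Module K M] :
    Submodule K (A →ₗ[K] A →ₗ[K] M) where
  carrier := {f | (∀ a b, f a b = f b a) ∧
    ∀ a b c, ε a • f b c - f (a * b) c + f a (b * c) - ε c • f a b = 0}
  add_mem' {f g} hf hg := ⟨fun a b => by simp [hf.1 a b, hg.1 a b], fun a b c => by
    have h := congrArg₂ (· + ·) (hf.2 a b c) (hg.2 a b c)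
    rw [add_zero] at h
    rw [← h]
    simp only [LinearMap.add_apply]
    module⟩
  zero_mem' := ⟨fun a b => by simp, fun a b c => by simp⟩
  smul_mem' r f hf := ⟨fun a b => by simp [hf.1 a b], fun a b c => by
    have h := congrArg (r • ·) (hf.2 a b c)
    rw [smul_zero] at h
    rw [← h]
    simp only [LinearMap.smul_apply]
    module⟩

/-- The coboundary of a 1-cochain in the Harrison complex. -/
def harrisonCoboundary (ε : A →ₐ[K] K) (M : Type x) [AddCommGroup M] [Module K M] :
    (A →ₗ[K] M) →ₗ[K] (A →ₗ[K] A →ₗ[K] M) where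
  toFun g := LinearMap.mk₂ K (fun a b => ε a • g b - g (a * b) + ε b • g a)
    (fun a a' b => by simp only [map_add, add_mul]; module)
    (fun c a b => by simp only [map_smul, smul_mul_assoc, smul_eq_mul]; module)
    (fun a b b' => by simp only [map_add, mul_add]; module)
    (fun c a b => by simp only [map_smul, mul_smul_comm, smul_eq_mul]; module)
  map_add' g h := by ext a b; simp only [LinearMap.mk₂_apply, LinearMap.add_apply]; module
  map_smul' c h := by
    ext a b; simp only [LinearMap.mk₂_apply, LinearMap.smul_apply, RingHom.id_apply]; module

instance (ε : A →ₐ[K] K) (M : Type x) [AddCommGroup M] [Module K M] : AddCommGroup (harrisonCocycles ε M) :=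
  inferInstance

/-- The Harrison cohomology `H^2_Harr(A; M)`, with `A` acting on `M` through `ε`. -/
abbrev HarrisonH2 (ε : A →ₐ[K] K) (M : Type x) [AddCommGroup M] [Module K M] : Type (max w x) :=
  harrisonCocycles ε M ⧸ ((LinearMap.range (harrisonCoboundary ε M)).submoduleOf (harrisonCocycles ε M) : Submodule K (harrisonCocycles ε M))

/-- The extension `0 → M → B → A → 0` of algebras given by a Harrison cocycle `f`: the vector space
`A × M` with `(a, m) (b, n) = (a b, a n + b m + f (a, b))`; its unit is `(1, -f (1, 1))`. -/
def Extension {ε : A →ₐ[K] K} {M : Type x} [AddCommGroup M] [Module K M] (_f : harrisonCocycles ε M) :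
  Type (max w x) := A × M

namespace Extension
variable {ε : A →ₐ[K] K} {M : Type x} [AddCommGroup M] [Module K M] (f : harrisonCocycles ε M)

instance : AddCommGroup (Extension f) := inferInstanceAs (AddCommGroup (A × M))
instance : Module K (Extension f) := inferInstanceAs (Module K (A × M))
/-- The projection `B → A`, as a linear map. -/
def fstL : Extension f →ₗ[K] A := LinearMap.fst K A M
/-- The linear projection `B → M`. -/
def sndL : Extension f →ₗ[K] M := LinearMap.snd K A M
/-- The linear splitting `q : A → B`. -/
def inlL : A →ₗ[K] Extension f := LinearMap.inl K A M
/-- The inclusion `i : M → B`. -/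
def inrL : M →ₗ[K] Extension f := LinearMap.inr K A M

instance : Mul (Extension f) where
  mul u v := (fstL f u * fstL f v, ε (fstL f u) • sndL f v + ε (fstL f v) • sndL f u +
    f.1 (fstL f u) (fstL f v))
instance : One (Extension f) where
  one := ((1 : A), -f.1 1 1)

variable {f}
@[ext] theorem ext {u v : Extension f} (h : fstL f u = fstL f v) (h' : sndL f u = sndL f v) : u = v :=
  Prod.ext h h'
@[simp] theorem fst_mul (u v : Extension f) : fstL f (u * v) = fstL f u * fstL f v := rfl
@[simp] theorem snd_mul (u v : Extension f) : sndL f (u * v) =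
  ε (fstL f u) • sndL f v + ε (fstL f v) • sndL f u + f.1 (fstL f u) (fstL f v) := rfl
@[simp] theorem fst_one : fstL f 1 = 1 := rfl
@[simp] theorem snd_one : sndL f 1 = -f.1 1 1 := rfl
@[simp] theorem fst_inl (a) : fstL f (inlL f a) = a := rfl
@[simp] theorem snd_inl (a) : sndL f (inlL f a) = 0 := rfl
@[simp] theorem fst_inr (a) : fstL f (inrL f a) = 0 := rfl
@[simp] theorem snd_inr (a) : sndL f (inrL f a) = a := rfl

theorem one_coc (f : harrisonCocycles ε M) (c : A) : f.1 1 c = ε c • f.1 1 1 := by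
  have h := f.2.2 1 1 c
  simp only [map_one, one_smul, one_mul, sub_self, zero_add] at h
  exact sub_eq_zero.mp h

variable (f)
theorem mul_comm' (u v : Extension f) : u * v = v * u := by
  ext
  · simp [mul_comm]
  · simp only [snd_mul, f.2.1 (fstL f u)]; abel
theorem one_mul' (u : Extension f) : 1 * u = u := by
  ext
  · simp
  · simp [one_coc f (fstL f u)]
theorem mul_add' (u v z : Extension f) : u * (v + z) = u * v + u * z := by
  ext
  · simp [mul_add]
  · simp only [snd_mul, map_add]; module
theorem mul_assoc' (u v z : Extension f) : u * v * z = u * (v * z) := by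
  ext
  · simp [mul_assoc]
  · have h := f.2.2 (fstL f u) (fstL f v) (fstL f z)
    rw [← sub_eq_zero, ← neg_eq_zero, ← h]
    simp only [snd_mul, fst_mul, map_mul, smul_add, mul_smul]
    module

instance : CommRing (Extension f) :=
  { (inferInstance : AddCommGroup (Extension f)), (inferInstance : Mul (Extension f)),
    (inferInstance : One (Extension f)) with
    mul_comm := mul_comm' f
    mul_assoc := mul_assoc' f
    one_mul := one_mul' f
    mul_one := fun u => by rw [mul_comm', one_mul']
    left_distrib := mul_add' f
    right_distrib := fun u v z => by rw [mul_comm', mul_add', mul_comm' f z, mul_comm' f z]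
    zero_mul := fun u => by rw [mul_comm']; ext <;> simp
    mul_zero := fun u => by ext <;> simp }

theorem smul_mul' (c : K) (u v : Extension f) : (c • u) * v = c • (u * v) := by
  ext
  · simp
  · simp only [snd_mul, map_smul, smul_add, smul_eq_mul, LinearMap.smul_apply]; module

instance : Algebra K (Extension f) :=
  Algebra.ofModule (smul_mul' f) (fun c u v => by rw [mul_comm, smul_mul', mul_comm])

/-- The projection `p : B → A`. -/
def proj : Extension f →ₐ[K] A := AlgHom.ofLinearMap (fstL f) rfl (fun _ _ => rfl)
@[simp] theorem proj_apply (u : Extension f) : proj f u = fstL f u := rfl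
/-- The augmentation of the extension. -/
def aug : Extension f →ₐ[K] K := ε.comp (proj f)


end Extension
end Harrison

section Deform
universe w x

theorem numNodes_succ {n : ℕ} {t : BinaryTree Unit} (h : t.numNodes = n + 1) :
    ∃ l r, t = .node () l r ∧ l.numNodes + r.numNodes = n := by
  rcases t with _ | ⟨_, l, r⟩
  · simp at h
  · exact ⟨l, r, rfl, by simpa using h⟩

theorem numNodes_zero {t : BinaryTree Unit} (h : t.numNodes = 0) : t = .nil := by
  rcases t with _ | ⟨_, l, r⟩
  · rfl
  · simp at h

theorem numNodes_one {t : BinaryTree Unit} (h : t.numNodes = 1) : t = .node () .nil .nil := by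
  obtain ⟨l, r, rfl, h⟩ := numNodes_succ h
  rw [numNodes_zero (t := l) (by omega), numNodes_zero (t := r) (by omega)]

theorem numNodes_two {t : BinaryTree Unit} (h : t.numNodes = 2) :
    t = .node () .nil (.node () .nil .nil) ∨ t = .node () (.node () .nil .nil) .nil := by
  obtain ⟨l, r, rfl, h⟩ := numNodes_succ h
  have : l.numNodes = 0 ∧ r.numNodes = 1 ∨ l.numNodes = 1 ∧ r.numNodes = 0 := by omega
  rcases this with ⟨h1, h2⟩ | ⟨h1, h2⟩
  · rw [numNodes_zero h1, numNodes_one h2]; simp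
  · rw [numNodes_zero h2, numNodes_one h1]; simp

theorem numNodes_three {t : BinaryTree Unit} (h : t.numNodes = 3) :
    t = .node () .nil (.node () .nil (.node () .nil .nil)) ∨
    t = .node () .nil (.node () (.node () .nil .nil) .nil) ∨
    t = .node () (.node () .nil .nil) (.node () .nil .nil) ∨
    t = .node () (.node () .nil (.node () .nil .nil)) .nil ∨
    t = .node () (.node () (.node () .nil .nil) .nil) .nil := by
  obtain ⟨l, r, rfl, h⟩ := numNodes_succ h
  have : l.numNodes = 0 ∧ r.numNodes = 2 ∨ l.numNodes = 1 ∧ r.numNodes = 1 ∨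
      l.numNodes = 2 ∧ r.numNodes = 0 := by omega
  rcases this with ⟨a, b⟩ | ⟨a, b⟩ | ⟨a, b⟩
  · rw [numNodes_zero a]; rcases numNodes_two b with rfl | rfl <;> simp
  · rw [numNodes_one a, numNodes_one b]; simp
  · rw [numNodes_zero b]; rcases numNodes_two a with rfl | rfl <;> simp

theorem treeSide_face {t : BinaryTree Unit} (h : t.numNodes = 4) :
    (treeSide 0 (delLeaf 3 t) = treeSide 0 t ∧ treeSide 2 (delLeaf 3 t) = treeSide 0 (delLeaf 0 t) ∧
      treeSide 3 t = treeSide 2 (delLeaf 0 t)) ∧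
    (treeSide 0 (delLeaf 2 t) = treeSide 0 t ∧ treeSide 2 t = treeSide 1 (delLeaf 0 t) ∧
      treeSide 2 (delLeaf 2 t) = treeSide 3 (delLeaf 0 t)) ∧
    (treeSide 1 (delLeaf 3 t) = treeSide 1 t ∧ treeSide 3 (delLeaf 3 t) = treeSide 0 (delLeaf 1 t) ∧
      treeSide 2 (delLeaf 1 t) = treeSide 2 (delLeaf 0 t)) ∧
    (treeSide 1 (delLeaf 4 t) = treeSide 1 t ∧ treeSide 3 (delLeaf 4 t) = treeSide 1 (delLeaf 1 t) ∧
      treeSide 3 (delLeaf 1 t) = treeSide 4 t) ∧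
    (treeSide 1 (delLeaf 2 t) = treeSide 0 (delLeaf 4 t) ∧
      treeSide 2 (delLeaf 4 t) = treeSide 1 (delLeaf 0 t) ∧
      treeSide 3 (delLeaf 2 t) = treeSide 4 t) := by
  obtain ⟨l, r, rfl, h⟩ := numNodes_succ h
  have : l.numNodes = 0 ∧ r.numNodes = 3 ∨ l.numNodes = 1 ∧ r.numNodes = 2 ∨
      l.numNodes = 2 ∧ r.numNodes = 1 ∨ l.numNodes = 3 ∧ r.numNodes = 0 := by omega
  rcases this with ⟨a, b⟩ | ⟨a, b⟩ | ⟨a, b⟩ | ⟨a, b⟩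
  · rw [numNodes_zero a]
    rcases numNodes_three b with rfl | rfl | rfl | rfl | rfl <;>
      exact ⟨⟨rfl, rfl, rfl⟩, ⟨rfl, rfl, rfl⟩, ⟨rfl, rfl, rfl⟩, ⟨rfl, rfl, rfl⟩, rfl, rfl, rfl⟩
  · rw [numNodes_one a]
    rcases numNodes_two b with rfl | rfl <;>
      exact ⟨⟨rfl, rfl, rfl⟩, ⟨rfl, rfl, rfl⟩, ⟨rfl, rfl, rfl⟩, ⟨rfl, rfl, rfl⟩, rfl, rfl, rfl⟩
  · rw [numNodes_one b]
    rcases numNodes_two a with rfl | rfl <;>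
      exact ⟨⟨rfl, rfl, rfl⟩, ⟨rfl, rfl, rfl⟩, ⟨rfl, rfl, rfl⟩, ⟨rfl, rfl, rfl⟩, rfl, rfl, rfl⟩
  · rw [numNodes_zero b]
    rcases numNodes_three a with rfl | rfl | rfl | rfl | rfl <;>
      exact ⟨⟨rfl, rfl, rfl⟩, ⟨rfl, rfl, rfl⟩, ⟨rfl, rfl, rfl⟩, ⟨rfl, rfl, rfl⟩, rfl, rfl, rfl⟩

/-- The map `g ⊗ id : V ⊗ D → K ⊗ D = D`. -/
def contract {V : Type*} [AddCommGroup V] [Module K V] (g : V →ₗ[K] K) : V ⊗[K] D →ₗ[K] D :=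
  (TensorProduct.lid K D).toLinearMap ∘ₗ LinearMap.rTensor D g

@[simp] theorem contract_tmul {V : Type*} [AddCommGroup V] [Module K V] (g : V →ₗ[K] K) (a : V)
    (d : D) : contract g (a ⊗ₜ[K] d) = g a • d := by simp [contract]

/-- A deformation of the dialgebra `D` with base `A` (augmented by `ε`): an `A`-dialgebra structure on
`A ⊗ D` such that `ε ⊗ id : A ⊗ D → D` is a morphism of dialgebras. -/
structure Deformation (𝒟 : Dialgebra K D) {A : Type w} [CommRing A] [Algebra K A]
    (ε : A →ₐ[K] K) extends Dialgebra A (A ⊗[K] D) where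
  compat : ∀ s u v, contract ε.toLinearMap (op s u v) =
    𝒟.op s (contract ε.toLinearMap u) (contract ε.toLinearMap v)

variable {A : Type w} [CommRing A] [Algebra K A]
variable {𝒟 : Dialgebra K D} {ε : A →ₐ[K] K} (η : Deformation 𝒟 ε) (f : harrisonCocycles ε K)
open Extension

/-- `Q = q ⊗ id : A ⊗ D → B ⊗ D`. -/
def liftQ : A ⊗[K] D →ₗ[K] Extension f ⊗[K] D := LinearMap.rTensor D (inlL f)
/-- `P = p ⊗ id : B ⊗ D → A ⊗ D`. -/
def liftP : Extension f ⊗[K] D →ₗ[K] A ⊗[K] D := LinearMap.rTensor D (fstL f)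
/-- `I = i ⊗ id : D = K ⊗ D → B ⊗ D`. -/
def liftI : D →ₗ[K] Extension f ⊗[K] D := TensorProduct.mk K (Extension f) D (inrL f 1)
/-- `E = ε ⊗ id : B ⊗ D → D`. -/
def liftE : Extension f ⊗[K] D →ₗ[K] D := contract (Extension.aug f).toLinearMap
/-- The retraction of `B ⊗ D` onto `D` complementary to `Q`; on `ker P = I(D)` it is the inverse
of `I`. -/
def liftS : Extension f ⊗[K] D →ₗ[K] D := contract (sndL f)

/-- The `B`-bilinear operations `{ , }` on `B ⊗ D` that lift the products of the deformation:
`{1 ⊗ x, 1 ⊗ y} = Q (1 ⊗ x * 1 ⊗ y)`. They satisfy `P {u, v} = P u * P v`, `{I d, u} = I (d * E u)`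
and `{u, I d} = I (E u * d)`, see `liftP_liftOp`, `liftOp_I_left` and `liftOp_I_right`. -/
def liftOp (s : Side) :
    Extension f ⊗[K] D →ₗ[Extension f] Extension f ⊗[K] D →ₗ[Extension f] Extension f ⊗[K] D :=
  ((LinearMap.liftBaseChangeEquiv (R := K) (M := D) (N := Extension f ⊗[K] D)
      (Extension f)).toLinearMap.restrictScalars K ∘ₗ
    LinearMap.mk₂ K (fun x y => liftQ f (η.op s (1 ⊗ₜ x) (1 ⊗ₜ y)))
      (fun x x' y => by simp [TensorProduct.tmul_add])
      (fun c x y => by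
        rw [TensorProduct.tmul_smul, ← algebraMap_smul A c (1 ⊗ₜ[K] x : A ⊗[K] D), map_smul,
          LinearMap.smul_apply, algebraMap_smul, map_smul])
      (fun x y y' => by simp [TensorProduct.tmul_add])
      (fun c x y => by
        rw [TensorProduct.tmul_smul, ← algebraMap_smul A c (1 ⊗ₜ[K] y : A ⊗[K] D), map_smul,
          algebraMap_smul, map_smul])).liftBaseChange (Extension f)

theorem liftOp_tmul (s : Side) (b c : Extension f) (x y : D) :
    liftOp η f s (b ⊗ₜ x) (c ⊗ₜ y) = (b * c) • liftQ f (η.op s (1 ⊗ₜ x) (1 ⊗ₜ y)) := by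
  simp [liftOp, mul_smul]


theorem liftP_smul (b : Extension f) (w : Extension f ⊗[K] D) :
    liftP f (b • w) = fstL f b • liftP f w := by
  induction w with
  | zero => simp
  | add u v hu hv => simp [smul_add, hu, hv]
  | tmul c d => simp [liftP, TensorProduct.smul_tmul']

theorem liftP_liftQ (u : A ⊗[K] D) : liftP f (liftQ f u) = u := by
  induction u with
  | zero => simp
  | add u v hu hv => simp [hu, hv]
  | tmul c d => simp [liftP, liftQ]

theorem op_tmul (s : Side) (a b : A) (x y : D) :
    η.op s (a ⊗ₜ x) (b ⊗ₜ y) = (a * b) • η.op s (1 ⊗ₜ x) (1 ⊗ₜ y) := by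
  have h1 : (a ⊗ₜ[K] x : A ⊗[K] D) = a • (1 ⊗ₜ x) := by simp [TensorProduct.smul_tmul']
  have h2 : (b ⊗ₜ[K] y : A ⊗[K] D) = b • (1 ⊗ₜ y) := by simp [TensorProduct.smul_tmul']
  rw [h1, h2, map_smul, map_smul, LinearMap.smul_apply, smul_smul, mul_comm]

theorem liftP_liftOp (s : Side) (u v : Extension f ⊗[K] D) :
    liftP f (liftOp η f s u v) = η.op s (liftP f u) (liftP f v) := by
  induction u with
  | zero => simp
  | add u u' hu hv => simp [hu, hv]
  | tmul b x =>
    induction v with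
    | zero => simp
    | add u u' hu hv => simp [hu, hv]
    | tmul c y =>
      rw [liftOp_tmul, liftP_smul, liftP_liftQ, fst_mul]
      simp only [liftP, LinearMap.rTensor_tmul]
      rw [op_tmul η s (fstL f b)]

theorem liftE_eq (u : Extension f ⊗[K] D) :
    liftE f u = contract ε.toLinearMap (liftP f u) := by
  induction u with
  | zero => simp
  | add u u' hu hv => simp [hu, hv]
  | tmul b x => simp [liftE, liftP, Extension.aug, Extension.proj_apply]

theorem liftE_liftOp (s : Side) (u v : Extension f ⊗[K] D) :
    liftE f (liftOp η f s u v) = 𝒟.op s (liftE f u) (liftE f v) := by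
  simp only [liftE_eq, liftP_liftOp, η.compat]

theorem liftE_one (x : D) : liftE f (1 ⊗ₜ x) = x := by simp [liftE]

theorem liftS_liftI (d : D) : liftS f (liftI f d) = d := by simp [liftS, liftI]

theorem eq_liftI (w : Extension f ⊗[K] D) : w = liftQ f (liftP f w) + liftI f (liftS f w) := by
  induction w with
  | zero => simp
  | add u v hu hv =>
    simp only [map_add]
    nth_rewrite 1 [hu, hv]
    abel
  | tmul b x =>
    have : b = inlL f (fstL f b) + sndL f b • inrL f 1 := by ext <;> simp
    nth_rewrite 1 [this]
    simp only [TensorProduct.add_tmul, liftQ, liftP, liftS, liftI, LinearMap.rTensor_tmul,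
      contract_tmul, TensorProduct.mk_apply, TensorProduct.smul_tmul]

theorem smul_liftI (b : Extension f) (d : D) : b • liftI f d = liftI f (ε (fstL f b) • d) := by
  have : b * inrL f 1 = ε (fstL f b) • inrL f 1 := by ext <;> simp
  simp only [liftI, TensorProduct.mk_apply, TensorProduct.smul_tmul', smul_eq_mul, this,
    TensorProduct.smul_tmul, map_smul]

theorem inr_smul (w : Extension f ⊗[K] D) : inrL f 1 • w = liftI f (liftE f w) := by
  induction w with
  | zero => simp
  | add u v hu hv => simp only [smul_add, map_add, hu, hv]
  | tmul b x =>
    have : b * inrL f 1 = ε (fstL f b) • inrL f 1 := by ext <;> simp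
    simp only [liftI, liftE, TensorProduct.mk_apply, TensorProduct.smul_tmul', smul_eq_mul,
      mul_comm _ b, this, contract_tmul, TensorProduct.smul_tmul]
    rfl

theorem liftI_eq (d : D) : liftI f d = inrL f 1 • (1 ⊗ₜ d) := by
  simp [liftI, TensorProduct.smul_tmul']

theorem liftOp_I_left (s : Side) (d : D) (u : Extension f ⊗[K] D) :
    liftOp η f s (liftI f d) u = liftI f (𝒟.op s d (liftE f u)) := by
  rw [liftI_eq, map_smul, LinearMap.smul_apply, inr_smul, liftE_liftOp, liftE_one]

theorem liftOp_I_right (s : Side) (u : Extension f ⊗[K] D) (d : D) :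
    liftOp η f s u (liftI f d) = liftI f (𝒟.op s (liftE f u) d) := by
  rw [liftI_eq, map_smul, inr_smul, liftE_liftOp, liftE_one]

theorem op_face (y : Y 3) (u v w : A ⊗[K] D) : η.op (y.side 0) u (η.op (y.side 2) v w) =
    η.op (y.side 3) (η.op (y.side 1) u v) w := by
  simp only [Y.side]
  rcases numNodes_three y.2 with h | h | h | h | h <;> rw [h]
  · exact η.assoc_left _ _ _
  · exact (η.bar_left _ _ _).symm
  · exact (η.assoc_mid _ _ _).symm
  · exact (η.bar_right _ _ _).symm
  · exact η.assoc_right _ _ _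

/-- The failure of the dialgebra axioms for the operations `{ , }`. With `⊣`, `⊢` standing for the two
operations, its values at the trees `[321]`, `[312]`, `[131]`, `[213]`, `[123]` are
`u ⊣ (v ⊣ w) - (u ⊣ v) ⊣ w`, `u ⊣ (v ⊢ w) - (u ⊣ v) ⊣ w`, `u ⊢ (v ⊣ w) - (u ⊢ v) ⊣ w`,
`u ⊢ (v ⊢ w) - (u ⊣ v) ⊢ w` and `u ⊢ (v ⊢ w) - (u ⊢ v) ⊢ w`. -/
def obsPhi (y : Y 3) (u v w : Extension f ⊗[K] D) : Extension f ⊗[K] D :=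
  liftOp η f (y.side 0) u (liftOp η f (y.side 2) v w) -
    liftOp η f (y.side 3) (liftOp η f (y.side 1) u v) w

theorem liftP_obsPhi (y : Y 3) (u v w : Extension f ⊗[K] D) : liftP f (obsPhi η f y u v w) = 0 := by
  rw [obsPhi, map_sub, liftP_liftOp, liftP_liftOp, liftP_liftOp, liftP_liftOp, op_face, sub_self]

/-- The obstruction cochain: the map induced by `obsPhi` from `D^3 = ((B ⊗ D) / ker E)^3` to
`ker P = D`, see `obsPhi_eq`. -/
def obsCochain : CY (D := D) K 3 := fun y =>
  MultilinearMap.mk' (fun a => liftS f (obsPhi η f y (1 ⊗ₜ a 0) (1 ⊗ₜ a 1) (1 ⊗ₜ a 2)))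
    (fun a i x x' => by
      fin_cases i <;> simp [obsPhi, TensorProduct.tmul_add] <;> abel)
    (fun a i c x => by
      fin_cases i <;> simp [obsPhi, smul_sub])

theorem obsCochain_apply (y : Y 3) (a : Fin 3 → D) : obsCochain η f y a =
    liftS f (obsPhi η f y (1 ⊗ₜ a 0) (1 ⊗ₜ a 1) (1 ⊗ₜ a 2)) := rfl

theorem obsPhi_one (y : Y 3) (a b c : D) : obsPhi η f y (1 ⊗ₜ a) (1 ⊗ₜ b) (1 ⊗ₜ c) =
      liftI f (obsCochain η f y ![a, b, c]) := by
  have h := eq_liftI f (obsPhi η f y (1 ⊗ₜ a) (1 ⊗ₜ b) (1 ⊗ₜ c))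
  rw [liftP_obsPhi, map_zero, zero_add] at h
  exact h

theorem obsPhi_eq (y : Y 3) (u v w : Extension f ⊗[K] D) :
    obsPhi η f y u v w =
      liftI f (obsCochain η f y ![liftE f u, liftE f v, liftE f w]) := by
  have key : ∀ a b c : D, obsCochain η f y ![a, b, c] =
      liftS f (obsPhi η f y (1 ⊗ₜ a) (1 ⊗ₜ b) (1 ⊗ₜ c)) := fun _ _ _ => rfl
  induction u with
  | zero => simp [key, obsPhi]
  | add u u' hu hv =>
    rw [show obsPhi η f y (u + u') v w = obsPhi η f y u v w + obsPhi η f y u' v w by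
      simp only [obsPhi, map_add, LinearMap.add_apply]; abel, hu, hv, ← map_add]
    congr 1
    simp only [key, obsPhi, map_add, LinearMap.add_apply, TensorProduct.tmul_add, map_sub]; abel
  | tmul b x =>
    induction v with
    | zero => simp [key, obsPhi]
    | add u u' hu hv =>
      rw [show ∀ v, obsPhi η f y v (u + u') w = obsPhi η f y v u w + obsPhi η f y v u' w by
        intro v; simp only [obsPhi, map_add, LinearMap.add_apply]; abel, hu, hv, ← map_add]
      congr 1
      simp only [key, obsPhi, map_add, LinearMap.add_apply, TensorProduct.tmul_add, map_sub]; abel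
    | tmul c z =>
      induction w with
      | zero => simp [key, obsPhi]
      | add u u' hu hv =>
        rw [show ∀ v w, obsPhi η f y v w (u + u') = obsPhi η f y v w u + obsPhi η f y v w u' by
          intro v w; simp only [obsPhi, map_add]; abel, hu, hv, ← map_add]
        congr 1
        simp only [key, obsPhi, map_add, TensorProduct.tmul_add, map_sub]; abel
      | tmul e t =>
        have h (b : Extension f) (x : D) : b ⊗ₜ[K] x = b • ((1 : Extension f) ⊗ₜ[K] x) := by
          simp [TensorProduct.smul_tmul']
        have h2 (b : Extension f) (x : D) : liftE f (b ⊗ₜ x) = ε (fstL f b) • x := by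
          simp [liftE, Extension.aug]
        have h3 : obsPhi η f y (b ⊗ₜ x) (c ⊗ₜ z) (e ⊗ₜ t) =
            (b * (c * e)) • obsPhi η f y (1 ⊗ₜ x) (1 ⊗ₜ z) (1 ⊗ₜ t) := by
          rw [h b, h c, h e]
          simp only [obsPhi, map_smul, LinearMap.smul_apply, smul_smul, smul_sub]
          congr 2 <;> ring
        have h4 : (![ε (fstL f b) • x, ε (fstL f c) • z, ε (fstL f e) • t] : Fin 3 → D) =
            fun i => ![ε (fstL f b), ε (fstL f c), ε (fstL f e)] i • ![x, z, t] i := by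
          ext i; fin_cases i <;> rfl
        rw [h3, obsPhi_one, smul_liftI, h2, h2, h2, h4, MultilinearMap.map_smul_univ]
        simp [Fin.prod_univ_three, mul_assoc]

/-- The identity behind the cocycle condition; it holds for any two bilinear operations. -/
theorem pentagon (y : Y 4) (u v w z : Extension f ⊗[K] D) :
    liftOp η f (y.side 0) u (obsPhi η f (y.face 0) v w z) -
      obsPhi η f (y.face 1) (liftOp η f (y.side 1) u v) w z +
      obsPhi η f (y.face 2) u (liftOp η f (y.side 2) v w) z -
      obsPhi η f (y.face 3) u v (liftOp η f (y.side 3) w z) +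
      liftOp η f (y.side 4) (obsPhi η f (y.face 4) u v w) z = 0 := by
  obtain ⟨⟨h1, h2, h3⟩, ⟨h4, h5, h6⟩, ⟨h7, h8, h9⟩, ⟨h10, h11, h12⟩, h13, h14, h15⟩ :=
    treeSide_face y.2
  simp only [obsPhi, map_sub, LinearMap.sub_apply, Y.side, Y.face, h1, h2, h3, h4, h5, h6, h7, h8,
    h9, h10, h11, h12, h13, h14, h15]
  abel

theorem obsCochain_mem (𝒟 : Dialgebra K D) (η : Deformation 𝒟 ε) :
    obsCochain η f ∈ cocycles 𝒟 3 := by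
  have hvec (a : Fin 3 → D) : a = ![a 0, a 1, a 2] := by ext i; fin_cases i <;> rfl
  have key (y : Y 3) (a : Fin 3 → D) :
      liftI f (obsCochain η f y a) = obsPhi η f y (1 ⊗ₜ a 0) (1 ⊗ₜ a 1) (1 ⊗ₜ a 2) := by
    rw [obsPhi_one, ← hvec]
  rw [cocycles, LinearMap.mem_ker]
  ext y a
  have hinj : Function.Injective (liftI (D := D) f) := fun d d' h => by
    simpa [liftS_liftI] using congrArg (liftS f) h
  apply hinj
  have h := pentagon η f y (1 ⊗ₜ a 0) (1 ⊗ₜ a 1) (1 ⊗ₜ a 2) (1 ⊗ₜ a 3)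
  simp only [obsPhi_eq, liftE_liftOp, liftE_one, liftOp_I_left, liftOp_I_right] at h
  rw [Pi.zero_apply, zero_apply, map_zero, ← h]
  simp only [← map_add, ← map_sub]
  congr 1
  have c0 : (fun i : Fin 3 => a i.succ) = ![a 1, a 2, a 3] := hvec _
  have c1 : Fin.contractNth (Fin.castSucc (0 : Fin 3)) (fun x z => 𝒟.op (y.side 1) x z) a =
    ![𝒟.op (y.side 1) (a 0) (a 1), a 2, a 3] := hvec _
  have c2 : Fin.contractNth (Fin.castSucc (1 : Fin 3)) (fun x z => 𝒟.op (y.side 2) x z) a =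
    ![a 0, 𝒟.op (y.side 2) (a 1) (a 2), a 3] := hvec _
  have c3 : Fin.contractNth (Fin.castSucc (2 : Fin 3)) (fun x z => 𝒟.op (y.side 3) x z) a =
    ![a 0, a 1, 𝒟.op (y.side 3) (a 2) (a 3)] := hvec _
  have c4 : (fun i : Fin 3 => a i.castSucc) = ![a 0, a 1, a 2] := hvec _
  have hδ : delta 𝒟 3 (obsCochain η f) y a =
      faceZero (𝒟.op (y.side 0)) (obsCochain η f (y.face 0)) a +
      ((-1 : K) ^ 1 • precompOp (𝒟.op (y.side 1)) 0 (obsCochain η f (y.face 1)) a +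
        (-1 : K) ^ 2 • precompOp (𝒟.op (y.side 2)) 1 (obsCochain η f (y.face 2)) a +
        (-1 : K) ^ 3 • precompOp (𝒟.op (y.side 3)) 2 (obsCochain η f (y.face 3)) a) +
      (-1 : K) ^ 4 • faceLast (𝒟.op (y.side 4)) (obsCochain η f (y.face 4)) a := by
    simp [delta, Fin.sum_univ_three]
  rw [hδ, faceZero_apply, faceLast_apply, precompOp_apply, precompOp_apply, precompOp_apply,
    c0, c1, c2, c3, c4]
  have : a (Fin.last 3) = a 3 := rfl
  rw [this]
  module


theorem liftS_inl_smul (a : A) (v : A ⊗[K] D) :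
    liftS f (inlL f a • liftQ f v) = contract (f.1 a) v := by
  induction v with
  | zero => simp
  | add u v hu hv => simp only [map_add, smul_add, hu, hv]
  | tmul b d => simp [liftS, liftQ, TensorProduct.smul_tmul']

theorem liftOp_one_Q (s : Side) (x : D) (a : A) (d : D) :
    liftOp η f s (1 ⊗ₜ x) (liftQ f (a ⊗ₜ d)) =
      inlL f a • liftQ f (η.op s (1 ⊗ₜ x) (1 ⊗ₜ d)) := by
  have h : liftQ f (a ⊗ₜ[K] d) = inlL f a ⊗ₜ d := by simp [liftQ]
  rw [h, liftOp_tmul, one_mul]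

theorem liftOp_Q_one (s : Side) (x : D) (a : A) (d : D) :
    liftOp η f s (liftQ f (a ⊗ₜ d)) (1 ⊗ₜ x) =
      inlL f a • liftQ f (η.op s (1 ⊗ₜ d) (1 ⊗ₜ x)) := by
  have h : liftQ f (a ⊗ₜ[K] d) = inlL f a ⊗ₜ d := by simp [liftQ]
  rw [h, liftOp_tmul, mul_one]

theorem liftOp_one_one (s : Side) (x y : D) : liftOp η f s (1 ⊗ₜ x) (1 ⊗ₜ y) =
    liftQ f (η.op s (1 ⊗ₜ x) (1 ⊗ₜ y)) := by
  rw [liftOp_tmul, one_mul, one_smul]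

theorem contract_linear {V : Type*} [AddCommGroup V] [Module K V] (g h : V →ₗ[K] K) (r : K)
    (v : V ⊗[K] D) : contract (r • g + h) v = r • contract g v + contract h v := by
  induction v with
  | zero => simp
  | add u v hu hv => simp only [map_add, hu, hv]; module
  | tmul b d => simp only [contract_tmul, LinearMap.add_apply, LinearMap.smul_apply]; module

theorem liftS_liftOp_Q_right (s : Side) (x : D) (u : A ⊗[K] D) (f g : harrisonCocycles ε K) (r : K) :
    liftS (r • f + g) (liftOp η (r • f + g) s (1 ⊗ₜ x) (liftQ (r • f + g) u)) =
    r • liftS f (liftOp η f s (1 ⊗ₜ x) (liftQ f u)) +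
      liftS g (liftOp η g s (1 ⊗ₜ x) (liftQ g u)) := by
  induction u with
  | zero => simp
  | add u v hu hv => simp only [map_add, hu, hv]; module
  | tmul a d =>
    simp only [liftOp_one_Q, liftS_inl_smul]
    exact contract_linear _ _ _ _

theorem liftS_liftOp_Q_left (s : Side) (x : D) (u : A ⊗[K] D) (f g : harrisonCocycles ε K) (r : K) :
    liftS (r • f + g) (liftOp η (r • f + g) s (liftQ (r • f + g) u) (1 ⊗ₜ x)) =
    r • liftS f (liftOp η f s (liftQ f u) (1 ⊗ₜ x)) +
      liftS g (liftOp η g s (liftQ g u) (1 ⊗ₜ x)) := by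
  induction u with
  | zero => simp
  | add u v hu hv => simp only [map_add, LinearMap.add_apply, hu, hv]; module
  | tmul a d =>
    simp only [liftOp_Q_one, liftS_inl_smul]
    exact contract_linear _ _ _ _

theorem obsCochain_linear (f g : harrisonCocycles ε K) (r : K) :
    obsCochain η (r • f + g) = r • obsCochain η f + obsCochain η g := by
  ext y a
  simp only [Pi.add_apply, Pi.smul_apply, add_apply, smul_apply,
    obsCochain_apply, obsPhi, map_sub, liftOp_one_one, liftS_liftOp_Q_right, liftS_liftOp_Q_left]
  module

/-- The obstruction cocycle as a linear function of the Harrison cocycle. -/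
def obsCocycle : harrisonCocycles ε K →ₗ[K] cocycles 𝒟 3 where
  toFun f := ⟨obsCochain η f, obsCochain_mem f 𝒟 η⟩
  map_add' f g := Subtype.ext (by simpa using obsCochain_linear η f g 1)
  map_smul' r f := Subtype.ext (by
    have h0 : obsCochain η (0 : harrisonCocycles ε K) = 0 := by
      simpa using obsCochain_linear η (0 : harrisonCocycles ε K) 0 1
    simpa [h0] using obsCochain_linear η f 0 r)

theorem contract_harrD1 (g : A →ₗ[K] K) (a : A) (v : A ⊗[K] D) :
    contract (harrisonCoboundary ε K g a) v =
      ε a • contract g v - contract g (a • v) + g a • contract ε.toLinearMap v := by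
  induction v with
  | zero => simp
  | add u v hu hv => simp only [map_add, smul_add, hu, hv]; module
  | tmul b d =>
    simp only [contract_tmul, harrisonCoboundary, LinearMap.coe_mk, AddHom.coe_mk, LinearMap.mk₂_apply,
      TensorProduct.smul_tmul', AlgHom.toLinearMap_apply, smul_eq_mul]
    module

theorem compat_one (s : Side) (x y : D) :
    contract ε.toLinearMap (η.op s (1 ⊗ₜ x) (1 ⊗ₜ y)) = 𝒟.op s x y := by
  simpa using η.compat s (1 ⊗ₜ x) (1 ⊗ₜ y)

theorem one_tmul_smul (c : K) (d : D) : (1 ⊗ₜ[K] (c • d) : A ⊗[K] D) = algebraMap K A c • (1 ⊗ₜ d) := by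
  rw [algebraMap_smul, TensorProduct.tmul_smul]

theorem op_one_smul_right (s : Side) (u : A ⊗[K] D) (c : K) (d : D) :
    η.op s u (1 ⊗ₜ (c • d)) = c • η.op s u (1 ⊗ₜ d) := by
  rw [one_tmul_smul, map_smul, algebraMap_smul]

theorem op_one_smul_left (s : Side) (u : A ⊗[K] D) (c : K) (d : D) :
    η.op s (1 ⊗ₜ (c • d)) u = c • η.op s (1 ⊗ₜ d) u := by
  rw [one_tmul_smul, map_smul, LinearMap.smul_apply, algebraMap_smul]

theorem obs_right {f : harrisonCocycles ε K} {g : A →ₗ[K] K} (hf : f.1 = harrisonCoboundary ε K g) (s : Side) (x : D)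
    (u : A ⊗[K] D) : liftS f (liftOp η f s (1 ⊗ₜ x) (liftQ f u)) =
      contract g (η.op s (1 ⊗ₜ x) (1 ⊗ₜ contract ε.toLinearMap u)) -
        contract g (η.op s (1 ⊗ₜ x) u) + 𝒟.op s x (contract g u) := by
  induction u with
  | zero => simp
  | add u v hu hv => simp only [map_add, hu, hv, TensorProduct.tmul_add]; abel
  | tmul a d =>
    rw [liftOp_one_Q, liftS_inl_smul, hf, contract_harrD1, compat_one, op_tmul η s 1 a, one_mul,
      contract_tmul, contract_tmul, op_one_smul_right]
    simp only [map_smul, AlgHom.toLinearMap_apply]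

theorem obs_left {f : harrisonCocycles ε K} {g : A →ₗ[K] K} (hf : f.1 = harrisonCoboundary ε K g) (s : Side) (x : D)
    (u : A ⊗[K] D) : liftS f (liftOp η f s (liftQ f u) (1 ⊗ₜ x)) =
      contract g (η.op s (1 ⊗ₜ contract ε.toLinearMap u) (1 ⊗ₜ x)) -
        contract g (η.op s u (1 ⊗ₜ x)) + 𝒟.op s (contract g u) x := by
  induction u with
  | zero => simp
  | add u v hu hv =>
    simp only [map_add, hu, hv, TensorProduct.tmul_add, LinearMap.add_apply]; abel
  | tmul a d =>
    rw [liftOp_Q_one, liftS_inl_smul, hf, contract_harrD1, compat_one, op_tmul η s a 1, mul_one,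
      contract_tmul, contract_tmul, op_one_smul_left]
    simp only [map_smul, LinearMap.smul_apply, AlgHom.toLinearMap_apply]

theorem side_face (y : Y 3) : (y.face 0).side 0 = y.side 2 ∧ (y.face 1).side 0 = y.side 3 ∧
    (y.face 2).side 0 = y.side 0 ∧ (y.face 3).side 0 = y.side 1 := by
  simp only [Y.side, Y.face]
  rcases numNodes_three y.2 with h | h | h | h | h <;> rw [h] <;> exact ⟨rfl, rfl, rfl, rfl⟩

/-- If `f` is the coboundary of `g`, this is a cochain whose coboundary is the obstruction cocycle. -/
def obsPrim (g : A →ₗ[K] K) : CY (D := D) K 2 := fun y =>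
  MultilinearMap.mk' (fun a => contract g (η.op (y.side 0) (1 ⊗ₜ a 0) (1 ⊗ₜ a 1)))
    (fun a i x x' => by fin_cases i <;> simp [TensorProduct.tmul_add])
    (fun a i c x => by
      fin_cases i <;> simp [-TensorProduct.tmul_smul, one_tmul_smul, -algebraMap_smul] <;>
      simp)

theorem obsCochain_coboundary {f : harrisonCocycles ε K} {g : A →ₗ[K] K} (hf : f.1 = harrisonCoboundary ε K g) :
    obsCochain η f = delta 𝒟 2 (obsPrim η g) := by
  obtain hs := side_face
  have hP (y : Y 2) (b c : D) : obsPrim η g y ![b, c] =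
      contract g (η.op (y.side 0) (1 ⊗ₜ b) (1 ⊗ₜ c)) := rfl
  have hvec (a : Fin 2 → D) : a = ![a 0, a 1] := by ext i; fin_cases i <;> rfl
  ext y a
  have c0 : (fun i : Fin 2 => a i.succ) = ![a 1, a 2] := hvec _
  have c1 : Fin.contractNth (Fin.castSucc (0 : Fin 2)) (fun x z => 𝒟.op (y.side 1) x z) a =
    ![𝒟.op (y.side 1) (a 0) (a 1), a 2] := hvec _
  have c2 : Fin.contractNth (Fin.castSucc (1 : Fin 2)) (fun x z => 𝒟.op (y.side 2) x z) a =
    ![a 0, 𝒟.op (y.side 2) (a 1) (a 2)] := hvec _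
  have c3 : (fun i : Fin 2 => a i.castSucc) = ![a 0, a 1] := hvec _
  have hδ : delta 𝒟 2 (obsPrim η g) y a =
      faceZero (𝒟.op (y.side 0)) (obsPrim η g (y.face 0)) a +
      ((-1 : K) ^ 1 • precompOp (𝒟.op (y.side 1)) 0 (obsPrim η g (y.face 1)) a +
        (-1 : K) ^ 2 • precompOp (𝒟.op (y.side 2)) 1 (obsPrim η g (y.face 2)) a) +
      (-1 : K) ^ 3 • faceLast (𝒟.op (y.side 3)) (obsPrim η g (y.face 3)) a := by
    simp [delta, Fin.sum_univ_two]
  rw [hδ, faceZero_apply, faceLast_apply, precompOp_apply, precompOp_apply, c0, c1, c2, c3]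
  simp only [hP, (hs y).1, (hs y).2.1, (hs y).2.2.1, (hs y).2.2.2]
  rw [obsCochain_apply, obsPhi, map_sub, liftOp_one_one, liftOp_one_one, obs_right η hf,
    obs_left η hf, op_face, compat_one, compat_one]
  have : a (Fin.last 2) = a 2 := rfl
  rw [this]
  module

/-- The obstruction map `H^2_Harr(A; K) → HY^3(D,D)` of a deformation with base `A`: it sends the
class of `f` to the obstruction to extending the deformation to the extension of `A` given by `f`. -/
def obstruction (η : Deformation 𝒟 ε) : HarrisonH2 ε K →ₗ[K] HY 𝒟 3 :=
  Submodule.mapQ _ _ (obsCocycle η) (by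
    rintro f ⟨g, hg⟩
    exact ⟨obsPrim η g, (obsCochain_coboundary η hg.symm).symm⟩)


section Step
variable {B : Type x} [CommRing B] [Algebra K B] {ε' : B →ₐ[K] K}

/-- `η'` is the push-out `φ_* η`. Here `b ⊗_A (a ⊗ x) ∈ B ⊗_A (A ⊗ D) = B ⊗ D` is `b • (φ ⊗ id) (a ⊗ x)`. -/
def IsPushout (φ : A →ₐ[K] B) (η : Deformation 𝒟 ε) (η' : Deformation 𝒟 ε') : Prop :=
  ∀ (s : Side) (b₁ b₂ : B) (u₁ u₂ : A ⊗[K] D),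
    η'.op s (b₁ • LinearMap.rTensor D φ.toLinearMap u₁) (b₂ • LinearMap.rTensor D φ.toLinearMap u₂) =
      (b₁ * b₂) • LinearMap.rTensor D φ.toLinearMap (η.op s u₁ u₂)

/-- `η` is the universal infinitesimal deformation, with base `K ⊕ HY^2(D,D)'`, built from some linear
choice `μ` of cocycles representing the classes in `HY^2(D,D)`. An element of
`A ⊗ D = D ⊕ Hom(HY^2(D,D), D)` is the pair `(x, φ)` with `x = pr u` and `φ α = co u`, and the second
component of `(x₁, φ₁) * (x₂, φ₂)` sends `α` to `μ α (x₁, x₂) + φ₁ α * x₂ + x₁ * φ₂ α`; the first one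
is `x₁ * x₂` by the definition of a deformation. -/
def IsUniversalInfinitesimal (e : A ≃ₐ[K] TrivSqZeroExt K (Module.Dual K (HY 𝒟 2)))
    (η : Deformation 𝒟 ε) : Prop :=
  ∃ μ : HY 𝒟 2 →ₗ[K] cocycles 𝒟 2, (∀ α, Submodule.Quotient.mk (μ α) = α) ∧
    ∀ (s : Side) (u₁ u₂ : A ⊗[K] D) (α : HY 𝒟 2),
      let pr : A ⊗[K] D →ₗ[K] D := contract ε.toLinearMap
      let co : A ⊗[K] D →ₗ[K] D := contract
        (Module.Dual.eval K (HY 𝒟 2) α ∘ₗ TrivSqZeroExt.sndHom K (Module.Dual K (HY 𝒟 2)) ∘ₗ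
          e.toLinearMap)
      co (η.op s u₁ u₂) = (μ α).1 (Y.two s) ![pr u₁, pr u₂] +
        𝒟.op s (co u₁) (pr u₂) + 𝒟.op s (pr u₁) (co u₂)

/-- The cocycle with values in `H^2_Harr(A; K)'` given by a choice `μ` of representing cocycles. -/
def universalCocycle (μ : HarrisonH2 ε K →ₗ[K] harrisonCocycles ε K) : harrisonCocycles ε (Module.Dual K (HarrisonH2 ε K)) :=
  ⟨LinearMap.mk₂ K (fun a b => (LinearMap.applyₗ b ∘ₗ LinearMap.applyₗ a) ∘ₗ (harrisonCocycles ε K).subtype ∘ₗ μ)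
    (fun a b c => by ext; simp) (fun a b c => by ext; simp) (fun a b c => by ext; simp)
    (fun a b c => by ext; simp),
    fun a b => LinearMap.ext fun h => (μ h).2.1 a b,
    fun a b c => LinearMap.ext fun h => (μ h).2.2 a b c⟩

/-- The image in `H^2_Harr(A; K)' ⊆ B` of the dual `HY^3(D,D)' → H^2_Harr(A; K)'` of the obstruction
map. -/
def nextIdeal (η : Deformation 𝒟 ε) (μ : HarrisonH2 ε K →ₗ[K] harrisonCocycles ε K) :
    Ideal (Extension (universalCocycle μ)) :=
  Ideal.span (inrL (universalCocycle μ) '' Set.range (obstruction η).dualMap)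

/-- The next base: the quotient of the extension of `A` by `H^2_Harr(A; K)'` by the image of
`HY^3(D,D)'`. -/
abbrev NextAlgebra (η : Deformation 𝒟 ε) (μ : HarrisonH2 ε K →ₗ[K] harrisonCocycles ε K) : Type (max u w) :=
  Extension (universalCocycle μ) ⧸ nextIdeal η μ

/-- The projection of the next base to `A`. -/
def nextProj (η : Deformation 𝒟 ε) (μ : HarrisonH2 ε K →ₗ[K] harrisonCocycles ε K) : NextAlgebra η μ →ₐ[K] A :=
  Ideal.Quotient.liftₐ (nextIdeal η μ) (proj (universalCocycle μ)) (fun c hc => by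
    have : nextIdeal η μ ≤ RingHom.ker (proj (universalCocycle μ)) := by
      rw [nextIdeal, Ideal.span_le]
      rintro _ ⟨m, -, rfl⟩
      simp [RingHom.mem_ker]
    exact this hc)

/-- `p : B → A` is, up to isomorphism over `A`, the extension of `A` constructed from the deformation
`η` and from some linear choice `μ` of cocycles representing the classes in `H^2_Harr(A; K)`. -/
def IsNextStep (η : Deformation 𝒟 ε) (p : B →ₐ[K] A) : Prop :=
  ∃ μ : HarrisonH2 ε K →ₗ[K] harrisonCocycles ε K, (∀ h, Submodule.Quotient.mk (μ h) = h) ∧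
    ∃ e : B ≃ₐ[K] NextAlgebra η μ, ∀ c, nextProj η μ (e c) = p c

end Step

/-- A sequence of bases `C_k` and deformations `η_k` produced by the inductive construction of a
miniversal deformation of `D`: `C_0 = K`, `C_1 = K ⊕ HY^2(D,D)'` with the universal infinitesimal
deformation `η_1`, and for `k ≥ 1` the algebra `C_{k+1}` is constructed from `(C_k, η_k)`, while
`η_{k+1}` is any deformation with base `C_{k+1}` whose push-out to `C_k` is `η_k`. -/
structure Tower (𝒟 : Dialgebra K D) where
  C : ℕ → Type w
  [commRing : ∀ k, CommRing (C k)]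
  [algebra : ∀ k, Algebra K (C k)]
  ε : ∀ k, C k →ₐ[K] K
  p : ∀ k, C (k + 1) →ₐ[K] C k
  η : ∀ k, Deformation 𝒟 (ε k)
  ε_p : ∀ k, (ε k).comp (p k) = ε (k + 1)
  push : ∀ k, IsPushout (p k) (η (k + 1)) (η k)
  zero : Function.Bijective (ε 0)
  one : ∃ e : C 1 ≃ₐ[K] TrivSqZeroExt K (Module.Dual K (HY 𝒟 2)),
    IsUniversalInfinitesimal e (η 1)
  succ : ∀ k, 1 ≤ k → IsNextStep (η k) (p k)

attribute [instance] Tower.commRing Tower.algebra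

/-- The inverse limit `C = lim C_k`. -/
def Tower.limit {𝒟 : Dialgebra K D} (T : Tower.{u, v, w} 𝒟) : Subalgebra K (∀ k, T.C k) where
  carrier := {c | ∀ k, T.p k (c (k + 1)) = c k}
  mul_mem' hc hd k := by simp [hc k, hd k]
  add_mem' hc hd k := by simp [hc k, hd k]
  algebraMap_mem' r k := by simp

end Deform
end DialgebraDeformation

/-!
The dual of a basis of `HY² = HY²(D, D)` is a basis of the maximal ideal of `C₁ = K ⊕ HY²'`. Lift it
to elements `c i` of `C = lim Cₖ`. Their components in each `Cₖ` are nilpotent, so sending the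
variables to the `c i` gives compatible maps of algebras from the power series ring to the `Cₖ`.

The map to `C₁` is onto. In the extension of `Cₖ` by `H²_Harr(Cₖ; K)'`, every element of the kernel
is decomposable: otherwise a derivation into `K` would be nonzero on it, and its restriction to
`Cₖ` would trivialise a nonzero class of `H²_Harr(Cₖ; K)`. This passes to the quotient `Cₖ₊₁`, so
lifts of generators of `Cₖ` generate `Cₖ₊₁`, and by induction the map to every `Cₖ` is onto.

The power series ring is linearly compact: infinitely many linear equations, each involving finitely
many coefficients, are solvable if every finite subsystem is. Hence the map to `C` is onto as well.
A power series in its kernel vanishes in `C₁`, where the variables are linearly independent, so it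
has no terms of degree at most one.
-/

namespace DialgebraDeformation

section LinearSystems

variable {K : Type*} [Field K] {ι : Type*}

theorem exists_dual_forall_apply_eq {V : Type*} [AddCommGroup V] [Module K V] (v : ι → V)
    (a : ι → K) (h : ∀ t : Finset ι, ∃ F : Module.Dual K V, ∀ i ∈ t, F (v i) = a i) :
    ∃ F : Module.Dual K V, ∀ i, F (v i) = a i := by
  have ha : Finsupp.linearCombination K a ∈
      LinearMap.range (Finsupp.linearCombination K v).dualMap := by
    rw [LinearMap.range_dualMap_eq_dualAnnihilator_ker, Submodule.mem_dualAnnihilator]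
    intro l hl
    obtain ⟨F, hF⟩ := h l.support
    calc Finsupp.linearCombination K a l = ∑ i ∈ l.support, l i • F (v i) :=
          (Finsupp.linearCombination_apply K l).trans
            (Finset.sum_congr rfl fun i hi => by rw [hF i hi])
      _ = F (Finsupp.linearCombination K v l) := by
          simp only [Finsupp.linearCombination_apply, Finsupp.sum, map_sum, map_smul]
      _ = 0 := by rw [LinearMap.mem_ker.1 hl, map_zero]
  obtain ⟨F, hF⟩ := ha
  exact ⟨F, fun i => by simpa using LinearMap.congr_fun hF (Finsupp.single i 1)⟩

theorem exists_forall_sum_smul_eq {S : Type*} {M : ι → Type*} [∀ i, AddCommGroup (M i)]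
    [∀ i, Module K (M i)] (s : ι → Finset S) (m : ∀ i, S → M i) (x : ∀ i, M i)
    (h : ∀ t : Finset ι, ∃ f : S → K, ∀ i ∈ t, ∑ d ∈ s i, f d • m i d = x i) :
    ∃ f : S → K, ∀ i, ∑ d ∈ s i, f d • m i d = x i := by
  classical
  let v (j : Σ i, Module.Dual K (M i)) : S →₀ K :=
    ∑ d ∈ s j.1, Finsupp.single d (j.2 (m j.1 d))
  have hv (f : S → K) (j : Σ i, Module.Dual K (M i)) :
      Finsupp.linearCombination K f (v j) = j.2 (∑ d ∈ s j.1, f d • m j.1 d) := by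
    simp [v, map_sum, mul_comm]
  obtain ⟨F, hF⟩ := exists_dual_forall_apply_eq v (fun j => j.2 (x j.1)) fun t => by
    obtain ⟨f, hf⟩ := h (t.image Sigma.fst)
    exact ⟨Finsupp.linearCombination K f, fun j hj => by
      rw [hv, hf j.1 (Finset.mem_image_of_mem _ hj)]⟩
  have hFf : F = Finsupp.linearCombination K fun d => F (Finsupp.single d 1) := by
    ext d
    simp
  refine ⟨fun d => F (Finsupp.single d 1), fun i => ?_⟩
  rw [← sub_eq_zero, ← Module.forall_dual_apply_eq_zero_iff K]
  intro l
  rw [map_sub, ← hv _ ⟨i, l⟩, ← hFf, hF, sub_self]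

end LinearSystems

section PowerSeries

variable {σ K : Type*} [Field K]

theorem ker_constantCoeff_eq_span_range_X (R : Type*) [CommRing R] [Finite σ] :
    RingHom.ker (MvPowerSeries.constantCoeff (σ := σ) (R := R)) =
      Ideal.span (Set.range MvPowerSeries.X) := by
  refine le_antisymm (fun f hf => ?_) (Ideal.span_le.2 ?_)
  · -- Power series are the adic completion of polynomials, and as the ideal of the variables is
    -- finitely generated, it generates the kernel of the reduction of the completion modulo it.
    let e := (MvPowerSeries.toAdicCompletionAlgEquiv σ R).toRingEquiv
    have hX : (MvPolynomial.idealOfVars σ R).map (algebraMap (MvPolynomial σ R)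
        (AdicCompletion (MvPolynomial.idealOfVars σ R) (MvPolynomial σ R))) =
        (Ideal.span (Set.range MvPowerSeries.X)).map e := by
      simp_rw [MvPolynomial.idealOfVars, Ideal.map_span, ← Set.range_comp]
      congr 2
      ext1 i
      simp [e, AdicCompletion.algebraMap_apply, ← MvPolynomial.coe_X,
        MvPowerSeries.toAdicCompletion_coe]
    have htrunc : MvPowerSeries.truncTotal 1 f = 0 := by
      ext d
      rw [MvPowerSeries.coeff_truncTotal_eq_ite]
      split_ifs with hd
      · rw [(Finsupp.degree_eq_zero_iff d).1 (by omega)]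
        exact hf
      · rfl
    have hef : e f ∈ RingHom.ker
        (AdicCompletion.evalOneₐ (MvPolynomial.idealOfVars σ R)).toRingHom := by
      change AdicCompletion.evalOneₐ _ (MvPowerSeries.toAdicCompletion σ R f) = 0
      rw [← AdicCompletion.factorₐ_evalₐ_one,
        ← AdicCompletion.factor_eval_eq_evalₐ _ _ (le_of_eq (Ideal.mul_top _)),
        AdicCompletion.eval_apply, MvPowerSeries.toAdicCompletion_apply_eq_mk_truncTotal, htrunc,
        map_zero, map_zero, map_zero]
    rw [AdicCompletion.ker_evalOneₐ_eq_map _ (MvPolynomial.idealOfVars_fg σ R), hX] at hef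
    obtain ⟨g, hg, hgf⟩ := (Ideal.mem_map_of_equiv ..).1 hef
    rwa [← e.injective hgf]
  · rintro _ ⟨i, rfl⟩
    exact MvPowerSeries.constantCoeff_X i

theorem mem_maximalIdeal_iff_constantCoeff_eq_zero {f : MvPowerSeries σ K} :
    f ∈ IsLocalRing.maximalIdeal (MvPowerSeries σ K) ↔ MvPowerSeries.constantCoeff f = 0 := by
  rw [IsLocalRing.mem_maximalIdeal, mem_nonunits_iff, MvPowerSeries.isUnit_iff_constantCoeff,
    isUnit_iff_ne_zero, not_not]

theorem algHom_apply_eq_constantCoeff (ψ : MvPowerSeries σ K →ₐ[K] K)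
    (f : MvPowerSeries σ K) : ψ f = MvPowerSeries.constantCoeff f := by
  have hmem : f - algebraMap K _ (ψ f) ∈ IsLocalRing.maximalIdeal (MvPowerSeries σ K) :=
    fun hunit => not_isUnit_zero (M₀ := K) (by simpa using hunit.map ψ)
  rw [mem_maximalIdeal_iff_constantCoeff_eq_zero, map_sub, sub_eq_zero] at hmem
  simpa [MvPowerSeries.algebraMap_apply] using hmem.symm

variable {R A : Type*} [CommRing R] [CommRing A] [Algebra R A] [Finite σ] {c : σ → A}

theorem finite_support_prod_pow (hc : ∀ i, IsNilpotent (c i)) :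
    (Function.support fun d : σ →₀ ℕ => d.prod fun i e => c i ^ e).Finite := by
  classical
  choose N hN using hc
  refine (Set.finite_Iic (Finsupp.equivFunOnFinite.symm N)).subset fun d hd i => ?_
  by_contra! hlt
  have hlt' : N i < d i := by simpa using hlt
  exact hd (Finset.prod_eq_zero (i := i) (Finsupp.mem_support_iff.2 (by omega))
    (pow_eq_zero_of_le hlt'.le (hN i)))

/-- The evaluation of power series in finitely many variables at nilpotent elements of an algebra.
It is the evaluation `MvPowerSeries.aeval` for the discrete topologies. -/
noncomputable def aevalNilpotent (hc : ∀ i, IsNilpotent (c i)) : MvPowerSeries σ R →ₐ[R] A :=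
  letI : UniformSpace R := ⊥
  letI : UniformSpace A := ⊥
  haveI : DiscreteUniformity R := ⟨rfl⟩
  haveI : DiscreteUniformity A := ⟨rfl⟩
  haveI : ContinuousSMul R A := ⟨continuous_of_discreteTopology⟩
  MvPowerSeries.aeval (a := c)
    { hpow := fun i => (hc i).isTopologicallyNilpotent
      tendsto_zero := by simp [Filter.cofinite_eq_bot] }

theorem aevalNilpotent_eq_sum (hc : ∀ i, IsNilpotent (c i)) (f : MvPowerSeries σ R) :
    aevalNilpotent hc f = ∑ d ∈ (finite_support_prod_pow hc).toFinset,
      MvPowerSeries.coeff d f • d.prod fun i e => c i ^ e := by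
  let _ : UniformSpace R := ⊥
  let _ : UniformSpace A := ⊥
  have : DiscreteUniformity R := ⟨rfl⟩
  have : DiscreteUniformity A := ⟨rfl⟩
  have : ContinuousSMul R A := ⟨continuous_of_discreteTopology⟩
  refine (MvPowerSeries.aeval_eq_sum _ f).trans (tsum_eq_sum fun d hd => ?_)
  rw [Set.Finite.mem_toFinset, Function.notMem_support] at hd
  rw [hd, smul_zero]

theorem aevalNilpotent_X (hc : ∀ i, IsNilpotent (c i)) (i : σ) :
    aevalNilpotent (R := R) hc (MvPowerSeries.X i) = c i := by
  let _ : UniformSpace R := ⊥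
  let _ : UniformSpace A := ⊥
  have : DiscreteUniformity R := ⟨rfl⟩
  have : DiscreteUniformity A := ⟨rfl⟩
  have : ContinuousSMul R A := ⟨continuous_of_discreteTopology⟩
  rw [← MvPolynomial.coe_X]
  exact (MvPowerSeries.aeval_coe _ _).trans (MvPolynomial.aeval_X c i)

theorem comp_aevalNilpotent {B : Type*} [CommRing B] [Algebra R B] (hc : ∀ i, IsNilpotent (c i))
    (ψ : A →ₐ[R] B) :
    ψ.comp (aevalNilpotent hc) = aevalNilpotent fun i => (hc i).map ψ := by
  let _ : UniformSpace R := ⊥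
  let _ : UniformSpace A := ⊥
  let _ : UniformSpace B := ⊥
  have : DiscreteUniformity R := ⟨rfl⟩
  have : DiscreteUniformity A := ⟨rfl⟩
  have : DiscreteUniformity B := ⟨rfl⟩
  have : ContinuousSMul R A := ⟨continuous_of_discreteTopology⟩
  have : ContinuousSMul R B := ⟨continuous_of_discreteTopology⟩
  exact MvPowerSeries.comp_aeval _ (continuous_of_discreteTopology (f := ψ))

theorem exists_forall_aevalNilpotent_eq {C : ℕ → Type*}
    [∀ k, CommRing (C k)] [∀ k, Algebra K (C k)] (p : ∀ k, C (k + 1) →ₐ[K] C k)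
    {c : ∀ k, σ → C k} (hc : ∀ k i, IsNilpotent (c k i)) (hcp : ∀ k i, p k (c (k + 1) i) = c k i)
    (hsurj : ∀ k, Function.Surjective (aevalNilpotent (R := K) (hc k)))
    {x : ∀ k, C k} (hx : ∀ k, p k (x (k + 1)) = x k) :
    ∃ f : MvPowerSeries σ K, ∀ k, aevalNilpotent (hc k) f = x k := by
  have hp (k : ℕ) (f : MvPowerSeries σ K) :
      p k (aevalNilpotent (hc (k + 1)) f) = aevalNilpotent (hc k) f := by
    rw [← AlgHom.comp_apply, comp_aevalNilpotent]
    simp only [hcp]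
  simp only [aevalNilpotent_eq_sum]
  refine exists_forall_sum_smul_eq (K := K) _
    (fun k (d : σ →₀ ℕ) => d.prod fun i e => c k i ^ e) x fun t => ?_
  obtain ⟨f, hf⟩ := hsurj (t.sup id) (x (t.sup id))
  have hle (k : ℕ) (hk : k ≤ t.sup id) : aevalNilpotent (hc k) f = x k := by
    induction hk using Nat.decreasingInduction with
    | self => exact hf
    | of_succ k _ ih => rw [← hp, ih, hx]
  exact ⟨f, fun k hk =>
    (aevalNilpotent_eq_sum (hc k) f).symm.trans (hle k (Finset.le_sup (f := id) hk))⟩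

end PowerSeries

section TrivSqZeroExt

variable {σ V : Type*} [AddCommGroup V] {b : σ → V}

theorem surjective_of_forall_apply_eq_inr {R : Type*} [CommRing R] [Module R V]
    [Module Rᵐᵒᵖ V] [IsCentralScalar R V] {S : Type*} [CommRing S] [Algebra R S]
    (φ : S →ₐ[R] TrivSqZeroExt R V) {s : σ → S} (hφ : ∀ i, φ (s i) = TrivSqZeroExt.inr (b i))
    (hb : ⊤ ≤ Submodule.span R (Set.range b)) : Function.Surjective φ := by
  have hinr : (⊤ : Submodule R V) ≤
      (LinearMap.range φ.toLinearMap).comap (TrivSqZeroExt.inrHom R V) :=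
    hb.trans (Submodule.span_le.2 (Set.range_subset_iff.2 fun i => ⟨s i, hφ i⟩))
  intro x
  obtain ⟨y, hy⟩ := hinr (Submodule.mem_top (x := x.snd))
  refine ⟨algebraMap R S x.fst + y, ?_⟩
  rw [map_add, AlgHom.commutes, TrivSqZeroExt.algebraMap_eq_inl]
  exact (congrArg _ hy).trans (TrivSqZeroExt.inl_fst_add_inr_snd_eq x)

theorem ker_le_maximalIdeal_sq_of_linearIndependent {K : Type*} [Field K] [Module K V]
    [Module Kᵐᵒᵖ V] [IsCentralScalar K V] [Finite σ] (φ : MvPowerSeries σ K →ₐ[K] TrivSqZeroExt K V)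
    (hφ : ∀ i, φ (MvPowerSeries.X i) = TrivSqZeroExt.inr (b i)) (hb : LinearIndependent K b) :
    RingHom.ker φ ≤ IsLocalRing.maximalIdeal (MvPowerSeries σ K) ^ 2 := by
  cases nonempty_fintype σ
  have hfst (g : MvPowerSeries σ K) : (φ g).fst = MvPowerSeries.constantCoeff g :=
    algHom_apply_eq_constantCoeff ((TrivSqZeroExt.fstHom K K V).comp φ) g
  intro f hf
  have hf0 : φ f = 0 := hf
  have hfspan : f ∈ Ideal.span (Set.range (MvPowerSeries.X (σ := σ) (R := K))) := by
    rw [← ker_constantCoeff_eq_span_range_X, RingHom.mem_ker, ← hfst, hf0, TrivSqZeroExt.fst_zero]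
  obtain ⟨g, rfl⟩ := Ideal.mem_span_range_iff_exists_fun.1 hfspan
  have hsum : ∑ i, MvPowerSeries.constantCoeff (g i) • b i = 0 := by
    simpa [hφ, hfst, TrivSqZeroExt.snd_sum] using congrArg TrivSqZeroExt.snd hf0
  rw [pow_two]
  refine Ideal.sum_mem _ fun i _ => Ideal.mul_mem_mul ?_ ?_
  · exact mem_maximalIdeal_iff_constantCoeff_eq_zero.2 (Fintype.linearIndependent_iff.1 hb _ hsum i)
  · exact mem_maximalIdeal_iff_constantCoeff_eq_zero.2 (MvPowerSeries.constantCoeff_X i)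

end TrivSqZeroExt

section SmallExtensions

variable {R A B : Type*} [CommRing R] [CommRing A] [Algebra R A] [CommRing B] [Algebra R B]
  {ε : A →ₐ[R] R} {p : B →ₐ[R] A}

/-- A surjection `p` onto an algebra augmented by `ε` is a small extension if the augmentation ideal
of its source annihilates its kernel. It is essential if, moreover, the kernel consists of
decomposable elements, so that algebra generators of the target lift to generators of the source. -/
structure IsEssentialSmallExtension (ε : A →ₐ[R] R) (p : B →ₐ[R] A) : Prop where
  surjective : Function.Surjective p
  mul_eq_zero {x y : B} (hx : p x = 0) (hy : ε (p y) = 0) : x * y = 0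
  ker_le : RingHom.ker p ≤ RingHom.ker (ε.comp p) ^ 2

namespace IsEssentialSmallExtension

theorem of_comp {E : Type*} [CommRing E] [Algebra R E] {q : E →ₐ[R] B}
    (hq : Function.Surjective q) (h : IsEssentialSmallExtension ε (p.comp q)) :
    IsEssentialSmallExtension ε p where
  surjective := Function.Surjective.of_comp h.surjective
  mul_eq_zero {x y} hx hy := by
    obtain ⟨u, rfl⟩ := hq x
    obtain ⟨v, rfl⟩ := hq y
    rw [← map_mul, h.mul_eq_zero (x := u) (y := v) hx hy, map_zero]
  ker_le := by
    rw [← Ideal.map_comap_of_surjective q hq (RingHom.ker p),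
      ← Ideal.map_comap_of_surjective q hq (RingHom.ker (ε.comp p)), ← Ideal.map_pow]
    exact Ideal.map_mono h.ker_le

theorem isNilpotent (h : IsEssentialSmallExtension ε p) {x : B} (hx : IsNilpotent (p x)) :
    IsNilpotent x := by
  obtain ⟨n, hn⟩ := hx
  have hpn : p (x ^ n) = 0 := by rw [map_pow, hn]
  exact ⟨n + n, by rw [pow_add, h.mul_eq_zero hpn (by rw [hpn, map_zero])]⟩

theorem surjective_of_comp (h : IsEssentialSmallExtension ε p) {S : Type*} [CommRing S]
    [Algebra R S] {φ : S →ₐ[R] B} (hφ : Function.Surjective (p.comp φ)) :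
    Function.Surjective φ := by
  have hlift (x : B) : ∃ s, p (x - φ s) = 0 := by
    obtain ⟨s, hs⟩ := hφ (p x)
    exact ⟨s, by rw [map_sub, sub_eq_zero]; exact hs.symm⟩
  have hdecomposable : ∀ z ∈ RingHom.ker (ε.comp p) ^ 2, z ∈ φ.range := by
    intro z hz
    rw [pow_two] at hz
    refine Submodule.mul_induction_on hz (fun x hx y hy => ?_) fun _ _ => φ.range.add_mem
    obtain ⟨s, hs⟩ := hlift x
    obtain ⟨t, ht⟩ := hlift y
    have hεs : ε (p (φ s)) = 0 := by
      rw [← sub_eq_zero.1 ((map_sub p x (φ s)).symm.trans hs)]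
      exact hx
    have hxy : x * y = φ s * φ t := by
      linear_combination h.mul_eq_zero hs (y := y) hy + h.mul_eq_zero ht hεs
    exact ⟨s * t, by rw [hxy]; exact map_mul φ s t⟩
  intro x
  obtain ⟨s, hs⟩ := hlift x
  obtain ⟨t, ht⟩ := hdecomposable _ (h.ker_le hs)
  exact ⟨t + s, by rw [map_add, show φ t = x - φ s from ht, sub_add_cancel]⟩

end IsEssentialSmallExtension

end SmallExtensions

open Extension

section Harrison

variable {K : Type*} [Field K] {A : Type*} [CommRing A] [Algebra K A] {ε : A →ₐ[K] K}

theorem exists_derivation_apply_ne_zero (ε : A →ₐ[K] K) {x : A} (hx : ε x = 0)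
    (hx' : x ∉ RingHom.ker ε ^ 2) :
    ∃ L : A →ₗ[K] K, L x ≠ 0 ∧ ∀ u v, L (u * v) = ε u * L v + ε v * L u := by
  obtain ⟨l, hlx, hl⟩ := Submodule.exists_le_ker_of_notMem (K := K)
    (p := (RingHom.ker ε ^ 2).restrictScalars K) (v := x)
    (by rwa [Submodule.restrictScalars_mem])
  let L : A →ₗ[K] K := l - (LinearMap.toSpanSingleton K K (l 1)).comp ε.toLinearMap
  have hL (u : A) : L u = l u - ε u * l 1 := by simp [L]
  refine ⟨L, by rwa [hL, hx, zero_mul, sub_zero], fun u v => ?_⟩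
  have hmem (u : A) : u - ε u • 1 ∈ RingHom.ker ε := by
    rw [RingHom.mem_ker, map_sub, map_smul, map_one, smul_eq_mul, mul_one, sub_self]
  have h : l ((u - ε u • 1) * (v - ε v • 1)) = 0 := by
    refine LinearMap.mem_ker.1 (hl ?_)
    rw [Submodule.restrictScalars_mem, pow_two]
    exact Ideal.mul_mem_mul (hmem u) (hmem v)
  simp only [sub_mul, mul_sub, smul_mul_assoc, mul_smul_comm, one_mul, mul_one, map_sub,
    map_smul, smul_eq_mul] at h
  rw [hL, hL, hL, map_mul ε]
  linear_combination h

theorem harrisonCoboundary_comp_inlL {M : Type*} [AddCommGroup M] [Module K M]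
    (f : harrisonCocycles ε M) (L : Extension f →ₗ[K] K)
    (hL : ∀ u v, L (u * v) = aug f u * L v + aug f v * L u) (a b : A) :
    harrisonCoboundary ε K (L ∘ₗ inlL f) a b = L (inrL f (f.1 a b)) := by
  have haug (c : A) : aug f (inlL f c) = ε c := congrArg ε (fst_inl (f := f) c)
  have hmul : inlL f a * inlL f b = inlL f (a * b) + inrL f (f.1 a b) := by ext <;> simp
  have h := hL (inlL f a) (inlL f b)
  rw [hmul, map_add, haug, haug] at h
  simp only [harrisonCoboundary, LinearMap.coe_mk, AddHom.coe_mk, LinearMap.mk₂_apply,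
    LinearMap.comp_apply, smul_eq_mul]
  linear_combination -h

/-- A functional on the fibre that extends to a derivation `L` into the residue field is evaluation
at a class whose cocycle is the coboundary of the restriction of `L`, hence it vanishes. -/
theorem ker_proj_universalCocycle_le [FiniteDimensional K (HarrisonH2 ε K)]
    (μ : HarrisonH2 ε K →ₗ[K] harrisonCocycles ε K) (hμ : ∀ h, Submodule.Quotient.mk (μ h) = h) :
    RingHom.ker (proj (universalCocycle μ)) ≤ RingHom.ker (aug (universalCocycle μ)) ^ 2 := by
  intro x hx
  have hx0 : fstL _ x = 0 := hx
  by_contra hxJ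
  obtain ⟨L, hLx, hL⟩ := exists_derivation_apply_ne_zero (aug (universalCocycle μ))
    ((congrArg ε hx0).trans (map_zero ε)) hxJ
  obtain ⟨h, hh⟩ := (Module.evalEquiv K (HarrisonH2 ε K)).surjective
    (L ∘ₗ inrL (universalCocycle μ))
  have hLinr (m : Module.Dual K (HarrisonH2 ε K)) : L (inrL (universalCocycle μ) m) = m h :=
    (LinearMap.congr_fun hh m).symm
  have hcoboundary : harrisonCoboundary ε K (L ∘ₗ inlL (universalCocycle μ)) = (μ h).1 := by
    refine LinearMap.ext fun a => LinearMap.ext fun b => ?_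
    rw [harrisonCoboundary_comp_inlL _ L hL, hLinr]
    rfl
  have hzero : h = 0 := by
    rw [← hμ h, Submodule.Quotient.mk_eq_zero]
    exact ⟨_, hcoboundary⟩
  have hxinr : x = inrL (universalCocycle μ) (sndL _ x) := by ext <;> simp [hx0]
  exact hLx (by rw [hxinr, hLinr, hzero, map_zero])

theorem isEssentialSmallExtension_proj [FiniteDimensional K (HarrisonH2 ε K)]
    (μ : HarrisonH2 ε K →ₗ[K] harrisonCocycles ε K) (hμ : ∀ h, Submodule.Quotient.mk (μ h) = h) :
    IsEssentialSmallExtension ε (proj (universalCocycle μ)) where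
  surjective a := ⟨inlL _ a, fst_inl (f := universalCocycle μ) a⟩
  mul_eq_zero {u v} hu hv := by
    have hu' : fstL _ u = 0 := hu
    have hv' : ε (fstL _ v) = 0 := hv
    ext <;> simp [hu', hv']
  ker_le := ker_proj_universalCocycle_le μ hμ

end Harrison

section NextStep

variable {K : Type*} [Field K] {D : Type*} [AddCommGroup D] [Module K D] {𝒟 : Dialgebra K D}
  {A : Type*} [CommRing A] [Algebra K A] {ε : A →ₐ[K] K} {η : Deformation 𝒟 ε}
  {B : Type*} [CommRing B] [Algebra K B] {p : B →ₐ[K] A}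

theorem IsNextStep.exists_comp_eq_proj (h : IsNextStep η p) :
    ∃ μ : HarrisonH2 ε K →ₗ[K] harrisonCocycles ε K, (∀ h, Submodule.Quotient.mk (μ h) = h) ∧
      ∃ q : Extension (universalCocycle μ) →ₐ[K] B, Function.Surjective q ∧
        p.comp q = proj (universalCocycle μ) := by
  obtain ⟨μ, hμ, e, he⟩ := h
  refine ⟨μ, hμ, e.symm.toAlgHom.comp (Ideal.Quotient.mkₐ K (nextIdeal η μ)),
    e.symm.surjective.comp Ideal.Quotient.mk_surjective, AlgHom.ext fun u => ?_⟩
  have hpe := he (e.symm (Ideal.Quotient.mkₐ K (nextIdeal η μ) u))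
  rw [e.apply_symm_apply] at hpe
  exact hpe.symm

theorem IsNextStep.finiteDimensional [FiniteDimensional K A] (h : IsNextStep η p) :
    FiniteDimensional K B := by
  obtain ⟨μ, -, q, hq, -⟩ := h.exists_comp_eq_proj
  have : FiniteDimensional K (Extension (universalCocycle μ)) :=
    inferInstanceAs (FiniteDimensional K (A × Module.Dual K (HarrisonH2 ε K)))
  exact FiniteDimensional.of_surjective q.toLinearMap hq

theorem IsNextStep.isEssentialSmallExtension [FiniteDimensional K A] (h : IsNextStep η p) :
    IsEssentialSmallExtension ε p := by
  obtain ⟨μ, hμ, q, hq, hpq⟩ := h.exists_comp_eq_proj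
  exact .of_comp hq (hpq ▸ isEssentialSmallExtension_proj μ hμ)

end NextStep

namespace Tower

variable {K : Type*} [Field K] {D : Type*} [AddCommGroup D] [Module K D] {𝒟 : Dialgebra K D}
  (T : Tower 𝒟)

theorem p_zero_surjective : Function.Surjective (T.p 0) :=
  fun x => ⟨algebraMap K _ (T.ε 0 x), T.zero.1 (by simp)⟩

variable [FiniteDimensional K (HY 𝒟 2)]

theorem finiteDimensional (k : ℕ) : FiniteDimensional K (T.C (k + 1)) := by
  induction k with
  | zero =>
    obtain ⟨e, -⟩ := T.one
    have : FiniteDimensional K (TrivSqZeroExt K (Module.Dual K (HY 𝒟 2))) :=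
      inferInstanceAs (FiniteDimensional K (K × Module.Dual K (HY 𝒟 2)))
    exact e.toLinearEquiv.symm.finiteDimensional
  | succ k ih => exact (T.succ (k + 1) (by omega)).finiteDimensional

theorem isEssentialSmallExtension_p (k : ℕ) :
    IsEssentialSmallExtension (T.ε (k + 1)) (T.p (k + 1)) :=
  have := T.finiteDimensional k
  (T.succ (k + 1) (by omega)).isEssentialSmallExtension

theorem exists_mem_limit (x : T.C 1) : ∃ c ∈ T.limit, c 1 = x := by
  let lift : ∀ k, T.C (k + 1) := Nat.rec x fun k y =>
    ((T.isEssentialSmallExtension_p k).surjective y).choose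
  let c : ∀ k, T.C k
    | 0 => T.p 0 x
    | k + 1 => lift k
  refine ⟨c, fun k => ?_, rfl⟩
  cases k with
  | zero => rfl
  | succ k => exact ((T.isEssentialSmallExtension_p k).surjective (lift k)).choose_spec

theorem isNilpotent_of_mem_limit {c : ∀ k, T.C k} (hc : c ∈ T.limit) (h1 : IsNilpotent (c 1)) :
    ∀ k, IsNilpotent (c k)
  | 0 => hc 0 ▸ h1.map (T.p 0)
  | 1 => h1
  | k + 2 => (T.isEssentialSmallExtension_p k).isNilpotent
      (by rw [hc]; exact isNilpotent_of_mem_limit hc h1 (k + 1))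

theorem algHom_surjective {S : Type*} [CommRing S] [Algebra K S] (φ : ∀ k, S →ₐ[K] T.C k)
    (hφ : ∀ k, (T.p k).comp (φ (k + 1)) = φ k) (h1 : Function.Surjective (φ 1)) :
    ∀ k, Function.Surjective (φ k)
  | 0 => hφ 0 ▸ T.p_zero_surjective.comp h1
  | 1 => h1
  | k + 2 => (T.isEssentialSmallExtension_p k).surjective_of_comp
      (by rw [hφ]; exact algHom_surjective φ hφ h1 (k + 1))

theorem exists_algHom_limit_surjective {σ : Type*} [Finite σ] {x : σ → T.C 1}
    (hx : ∀ i, IsNilpotent (x i))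
    (hgen : Function.Surjective (aevalNilpotent (R := K) hx)) :
    ∃ Φ : MvPowerSeries σ K →ₐ[K] T.limit, Function.Surjective Φ ∧
      ∀ f, (Φ f).1 1 = aevalNilpotent hx f := by
  choose c hc hc1 using fun i => T.exists_mem_limit (x i)
  obtain rfl : (fun i => c i 1) = x := funext hc1
  have hnil (k : ℕ) (i : σ) : IsNilpotent (c i k) := T.isNilpotent_of_mem_limit (hc i) (hx i) k
  have hcompat (k : ℕ) : (T.p k).comp (aevalNilpotent (hnil (k + 1))) =
      aevalNilpotent (R := K) (hnil k) := by
    rw [comp_aevalNilpotent]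
    simp only [hc _ k]
  let Φ : MvPowerSeries σ K →ₐ[K] T.limit :=
    (AlgHom.pi fun k => aevalNilpotent (hnil k)).codRestrict T.limit fun f k =>
      DFunLike.congr_fun (hcompat k) f
  refine ⟨Φ, fun y => ?_, fun f => rfl⟩
  obtain ⟨f, hf⟩ := exists_forall_aevalNilpotent_eq T.p hnil (fun k i => hc i k)
    (T.algHom_surjective _ hcompat hgen) y.2
  exact ⟨f, Subtype.ext (funext hf)⟩

end Tower

end DialgebraDeformation

open DialgebraDeformation in
theorem mainTheorem10_general {K : Type*} [Field K] {D : Type*} [AddCommGroup D] [Module K D]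
    (𝒟 : Dialgebra K D) {σ : Type*} [Finite σ]
    (b : Module.Basis σ K (HY 𝒟 2)) (T : Tower 𝒟) :
    ∃ I : Ideal (MvPowerSeries σ K), I ≤ IsLocalRing.maximalIdeal (MvPowerSeries σ K) ^ 2 ∧
      Nonempty (T.limit ≃ₐ[K] (MvPowerSeries σ K ⧸ I)) := by
  classical
  have := Module.Finite.of_basis b
  obtain ⟨e, -⟩ := T.one
  let x (i : σ) : T.C 1 := e.symm (TrivSqZeroExt.inr (b.dualBasis i))
  have hx (i : σ) : IsNilpotent (x i) := by
    refine IsNilpotent.map ⟨2, ?_⟩ e.symm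
    rw [pow_two, TrivSqZeroExt.inr_mul_inr]
  let φ := e.toAlgHom.comp (aevalNilpotent (R := K) hx)
  have hφX (i : σ) : φ (MvPowerSeries.X i) = TrivSqZeroExt.inr (b.dualBasis i) :=
    (congrArg e (aevalNilpotent_X hx i)).trans (e.apply_symm_apply _)
  have hφ : Function.Surjective φ :=
    surjective_of_forall_apply_eq_inr φ hφX b.dualBasis.span_eq.ge
  obtain ⟨Φ, hΦ, hΦ1⟩ := T.exists_algHom_limit_surjective hx
    (Function.Surjective.of_comp_left hφ e.injective)
  refine ⟨RingHom.ker Φ, fun f hf => ?_, ⟨(Ideal.quotientKerAlgEquivOfSurjective hΦ).symm⟩⟩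
  refine ker_le_maximalIdeal_sq_of_linearIndependent φ hφX b.dualBasis.linearIndependent ?_
  have hf1 : aevalNilpotent hx f = 0 := by rw [← hΦ1, hf]; rfl
  rw [RingHom.mem_ker]
  exact (congrArg e hf1).trans (map_zero e)

theorem mainTheorem10 {K : Type*} [Field K] [CharZero K] {D : Type*} [AddCommGroup D] [Module K D]
    (𝒟 : DialgebraDeformation.Dialgebra K D)
    [FiniteDimensional K (DialgebraDeformation.HY 𝒟 2)]
    (T : DialgebraDeformation.Tower 𝒟) :
    ∃ I : Ideal (MvPowerSeries (Fin (Module.finrank K (DialgebraDeformation.HY 𝒟 2))) K),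
      I ≤ IsLocalRing.maximalIdeal
        (MvPowerSeries (Fin (Module.finrank K (DialgebraDeformation.HY 𝒟 2))) K) ^ 2 ∧
      Nonempty (T.limit ≃ₐ[K]
        (MvPowerSeries (Fin (Module.finrank K (DialgebraDeformation.HY 𝒟 2))) K ⧸ I)) :=
  mainTheorem10_general 𝒟 (Module.finBasis K (DialgebraDeformation.HY 𝒟 2)) T
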